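/- Let $N\ge 1$ and let $Q\subset\mathbf R^N$ be a fixed open cube with edges parallel to the coordinate axes. Let $1\le p<\infty$, and let $m$ be a positive integer. For a multi-index $\beta$ let $D^\beta$ denote the weak derivative, let $W^{m,p}(Q)$ be the set of $u\in L^p(Q)$ with $D^\beta u\in L^p(Q)$ for all $|\beta|\le m$, and put $\|\nabla^j u\|_{L^p(Q)}=\sum_{|\beta|=j}\|D^\beta u\|_{L^p(Q)}$. For $u\in W^{r+1,p}(Q)$ let $\Pi_{r,r,p}u$ be a polynomial $P$ of degree at most $r$ that minimizes $\sum_{i=0}^r\|\nabla^i(u-P)\|_{L^p(Q)}$ among all polynomials of degree at most $r$ (if the minimizer is not unique, which can happen only for $p=1$, any choice of minimizers is fixed). For $0\le r'\le r$ let $\Pi_{r,r',p}u$ be the sum of the homogeneous parts of $\Pi_{r,r,p}u$ of degree at most $r'$, and $\Pi^{\rm co}_{r,r',p}u=\Pi_{r,r,p}u-\Pi_{r,r',p}u$. For $\alpha>0$, $0\le k\le m-1$ and $\mathcal A\subset W^{m,p}(Q)$ let $T^\alpha_{m,k,p,\mathcal A}$ be the set of $u\in\mathcal A$ with $$\|\Pi_{m-1,k,p}u\|_{L^p(Q)}\ge\alpha\|\Pi^{\rm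 co}_{m-1,k,p}u\|_{L^p(Q)}\quad\text{and}\quad \|u-\Pi_{m-1,m-1,p}u\|_{L^p(Q)}\le\tfrac12\|\Pi_{m-1,m-1,p}u\|_{L^p(Q)},$$ and put $$\Theta^\alpha_{m,k,p}(\mathcal A)=\min\Bigl[\inf_u\frac{\|\nabla^m u\|^p_{L^p(Q)}}{\|\Pi_{m-1,k,p}u\|^p_{L^p(Q)}},\,1\Bigr],$$ where the infimum is over all $u\in T^\alpha_{m,k,p,\mathcal A}$ with $\Pi_{m-1,k,p}u\ne0$ and is $+\infty$ if there is no such $u$. Proposition 2.19. For every $\alpha>0$ (in particular, for every large $\alpha$) there are constants $\alpha'>0$ and $C>0$, depending only on $Q$ (hence $N$), $m$, $p$ and $\alpha$, such that the following holds for all integers $k,s$ with $0<s\le k\le m-1$ and for every set $\mathcal A\subset W^{m,p}(Q)$: there are a multi-index $\gamma$ with $|\gamma|=s$ and a multi-index $\delta\le\gamma$ such that $$\Theta^{\alpha'}_{m-s,k-s,p}(D^\gamma\mathcal A)\le C\,\Theta^\alpha_{m,k,p}(\mathcal A)\qquad\text{or}\qquad \Theta^{\alpha'}_{m-|\delta|,0,p}(D^\delta\mathcal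 A)\le C\,\Theta^\alpha_{m,k,p}(\mathcal A),$$ where $D^\beta\mathcal A=\{D^\beta u:u\in\mathcal A\}$. -/

import Mathlib

open MeasureTheory
open scoped ENNReal ContDiff

noncomputable section

namespace PolyCap

variable {N : ℕ}

/-- A nondegenerate cube in `ℝ^N` with edges parallel to the coordinate axes. -/
structure Cube (N : ℕ) where
  center : Fin N → ℝ
  side : ℝ
  side_pos : 0 < side

/-- The (open) cube as a set of points. -/
def Cube.toSet (Q : Cube N) : Set (Fin N → ℝ) :=
  {x | ∀ i, |x i - Q.center i| < Q.side / 2}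

/-- Lebesgue measure on the cube. -/
abbrev Cube.vol (Q : Cube N) : Measure (Fin N → ℝ) := volume.restrict Q.toSet

/-- The order `|γ|` of a multi-index. -/
def order (γ : Fin N → ℕ) : ℕ := ∑ i, γ i

/-- The classical partial derivative `∂_i φ`. -/
def partialDeriv (i : Fin N) (φ : (Fin N → ℝ) → ℝ) : (Fin N → ℝ) → ℝ :=
  fun x => fderiv ℝ φ x (Pi.single i 1)

/-- The classical derivative `∂_0^{γ 0} ⋯ ∂_{N-1}^{γ (N-1)} φ`. -/
def multiDeriv (γ : Fin N → ℕ) (φ : (Fin N → ℝ) → ℝ) : (Fin N → ℝ) → ℝ :=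
  (List.finRange N).foldr (fun i ψ => (partialDeriv i)^[γ i] ψ) φ

/-- Test functions `C_0^∞(Q)`. -/
def IsTest (Q : Cube N) (φ : (Fin N → ℝ) → ℝ) : Prop :=
  ContDiff ℝ ∞ φ ∧ HasCompactSupport φ ∧ tsupport φ ⊆ Q.toSet

/-- `v` is the distributional derivative `D^γ u` in the open cube `Q`. -/
def IsWeakDeriv (Q : Cube N) {p : ℝ≥0∞} (γ : Fin N → ℕ) (u v : Lp ℝ p Q.vol) : Prop :=
  ∀ φ, IsTest Q φ →
    ∫ x in Q.toSet, u x * multiDeriv γ φ x = (-1) ^ order γ * ∫ x in Q.toSet, v x * φ x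

/-- The Sobolev space `W^{m,p}(Q)`. -/
def sobolev (Q : Cube N) (m : ℕ) (p : ℝ≥0∞) : Set (Lp ℝ p Q.vol) :=
  {u | ∀ γ : Fin N → ℕ, order γ ≤ m → ∃ v : Lp ℝ p Q.vol, IsWeakDeriv Q γ u v}

open Classical in
/-- The weak derivative `D^γ u`, an element of `L^p(Q)`, for those `u` that have one. -/
def weakDeriv (Q : Cube N) {p : ℝ≥0∞} (γ : Fin N → ℕ) (u : Lp ℝ p Q.vol) : Lp ℝ p Q.vol :=
  if h : ∃ v : Lp ℝ p Q.vol, IsWeakDeriv Q γ u v then h.choose else 0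

/-- `‖∇^j u‖_{L^p(Q)} = ∑_{|β| = j} ‖D^β u‖_{L^p(Q)}`. -/
def gradNorm (Q : Cube N) {p : ℝ≥0∞} (j : ℕ) (u : Lp ℝ p Q.vol) : ℝ :=
  ∑ β ∈ Finset.piAntidiag (Finset.univ : Finset (Fin N)) j, ‖weakDeriv Q β u‖

theorem Cube.toSet_eq_ball (Q : Cube N) : Q.toSet = Metric.ball Q.center (Q.side / 2) := by
  ext x
  rw [Metric.mem_ball, dist_pi_lt_iff (half_pos Q.side_pos)]
  simp [Cube.toSet, Real.dist_eq]

theorem Cube.isOpen (Q : Cube N) : IsOpen Q.toSet := by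
  rw [Q.toSet_eq_ball]; exact Metric.isOpen_ball

instance (Q : Cube N) : IsFiniteMeasure Q.vol := by
  refine ⟨?_⟩
  rw [Measure.restrict_apply_univ, Q.toSet_eq_ball]
  exact measure_ball_lt_top

theorem continuous_evalPoly (P : MvPolynomial (Fin N) ℝ) :
    Continuous fun x : Fin N → ℝ => MvPolynomial.eval x P :=
  MvPolynomial.continuous_eval P

theorem memLp_poly (Q : Cube N) (p : ℝ≥0∞) (P : MvPolynomial (Fin N) ℝ) :
    MemLp (fun x => MvPolynomial.eval x P) p Q.vol := by
  obtain ⟨C, hC⟩ := (isCompact_closedBall Q.center (Q.side / 2)).exists_bound_of_continuousOn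
    (continuous_evalPoly P).continuousOn
  refine MemLp.of_bound (continuous_evalPoly P).aestronglyMeasurable C ?_
  refine (ae_restrict_iff' Q.isOpen.measurableSet).2 (Filter.Eventually.of_forall fun x hx => ?_)
  rw [Q.toSet_eq_ball] at hx
  exact hC x (Metric.ball_subset_closedBall hx)

/-- A polynomial, restricted to `Q`, as an element of `L^p(Q)`. -/
def polyLp (Q : Cube N) (p : ℝ≥0∞) (P : MvPolynomial (Fin N) ℝ) : Lp ℝ p Q.vol :=
  (memLp_poly Q p P).toLp _

/-- `P` is a polynomial of degree at most `r` that minimizes `∑_{i ≤ r} ‖∇^i (u - P)‖_{L^p(Q)}`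
among all polynomials of degree at most `r`. -/
def IsBestPoly (Q : Cube N) {p : ℝ≥0∞} (r : ℕ) (u : Lp ℝ p Q.vol)
    (P : MvPolynomial (Fin N) ℝ) : Prop :=
  P.totalDegree ≤ r ∧ ∀ R : MvPolynomial (Fin N) ℝ, R.totalDegree ≤ r →
    ∑ i ∈ Finset.range (r + 1), gradNorm Q i (u - polyLp Q p P) ≤
      ∑ i ∈ Finset.range (r + 1), gradNorm Q i (u - polyLp Q p R)

/-- `Proj r u` is, for each `r` and each `u ∈ W^{r+1,p}(Q)`, a choice of the polynomial `Π_{r,r,p} u`.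
The choice is forced for `p > 1`; for `p = 1` there may be several. -/
def IsProjection (Q : Cube N) (p : ℝ≥0∞)
    (Proj : ℕ → Lp ℝ p Q.vol → MvPolynomial (Fin N) ℝ) : Prop :=
  ∀ (r : ℕ) (u : Lp ℝ p Q.vol), u ∈ sobolev Q (r + 1) p → IsBestPoly Q r u (Proj r u)

/-- The part of degree at most `k` of a polynomial. -/
def lowPart (k : ℕ) (P : MvPolynomial (Fin N) ℝ) : MvPolynomial (Fin N) ℝ :=
  ∑ i ∈ Finset.range (k + 1), MvPolynomial.homogeneousComponent i P

/-- `‖Π_{r,k,p} u‖_{L^p(Q)}` where `P = Π_{r,r,p} u`. -/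
def lowNorm (Q : Cube N) (p : ℝ≥0∞) (k : ℕ) (P : MvPolynomial (Fin N) ℝ) : ℝ :=
  ‖polyLp Q p (lowPart k P)‖

/-- `‖Π^{co}_{r,k,p} u‖_{L^p(Q)}` where `P = Π_{r,r,p} u`. -/
def coNorm (Q : Cube N) (p : ℝ≥0∞) (k : ℕ) (P : MvPolynomial (Fin N) ℝ) : ℝ :=
  ‖polyLp Q p (P - lowPart k P)‖

/-- The set `T^α_{m,k,p,𝒜}`. -/
def testSet (Q : Cube N) {p : ℝ≥0∞} (Proj : ℕ → Lp ℝ p Q.vol → MvPolynomial (Fin N) ℝ)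
    (α : ℝ) (m k : ℕ) (A : Set (Lp ℝ p Q.vol)) : Set (Lp ℝ p Q.vol) :=
  {u | u ∈ A ∧ α * coNorm Q p k (Proj (m - 1) u) ≤ lowNorm Q p k (Proj (m - 1) u) ∧
    ‖u - polyLp Q p (Proj (m - 1) u)‖ ≤ 1 / 2 * ‖polyLp Q p (Proj (m - 1) u)‖}

/-- The capacity `Θ^α_{m,k,p}(𝒜)`. The infimum is over the `u` for which the quotient is defined,
that is, `Π_{m-1,k,p} u ≠ 0` (this leaves out only `u = 0`); an empty infimum is `∞`. -/
def theta (Q : Cube N) {p : ℝ≥0∞} (Proj : ℕ → Lp ℝ p Q.vol → MvPolynomial (Fin N) ℝ)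
    (α : ℝ) (m k : ℕ) (A : Set (Lp ℝ p Q.vol)) : ℝ≥0∞ :=
  min (⨅ u ∈ {u ∈ testSet Q Proj α m k A | lowNorm Q p k (Proj (m - 1) u) ≠ 0},
    ENNReal.ofReal (gradNorm Q m u ^ p.toReal / lowNorm Q p k (Proj (m - 1) u) ^ p.toReal)) 1

theorem IsTest.partialDeriv {Q : Cube N} {φ : (Fin N → ℝ) → ℝ} (h : IsTest Q φ) (i : Fin N) :
    IsTest Q (partialDeriv i φ) := by
  refine ⟨?_, ?_, ?_⟩
  · exact (h.1.fderiv_right (m := ∞) (by simp)).clm_apply contDiff_const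
  · exact h.2.1.fderiv_apply (𝕜 := ℝ) _
  · exact (tsupport_fderiv_apply_subset ℝ _).trans h.2.2

theorem partialDeriv_byParts {Q : Cube N} {f φ : (Fin N → ℝ) → ℝ} (hf : ContDiff ℝ ∞ f)
    (h : IsTest Q φ) (i : Fin N) :
    ∫ x, f x * partialDeriv i φ x = - ∫ x, partialDeriv i f x * φ x := by
  have hf' : Continuous (partialDeriv i f) :=
    ((hf.fderiv_right (m := ∞) (by simp)).clm_apply contDiff_const).continuous
  have h' := h.partialDeriv i
  refine integral_mul_fderiv_eq_neg_fderiv_mul_of_integrable ?_ ?_ ?_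
    (fun x _ => (hf.differentiable (by simp)).differentiableAt)
    (fun x _ => (h.1.differentiable (by simp)).differentiableAt)
  · exact (hf'.mul h.1.continuous).integrable_of_hasCompactSupport h.2.1.mul_left
  · exact (hf.continuous.mul h'.1.continuous).integrable_of_hasCompactSupport h'.2.1.mul_left
  · exact (hf.continuous.mul h.1.continuous).integrable_of_hasCompactSupport h.2.1.mul_left

theorem iterate_byParts (Q : Cube N) (i : Fin N) (n : ℕ) :
    ∀ f : (Fin N → ℝ) → ℝ, ContDiff ℝ ∞ f → ∃ g : (Fin N → ℝ) → ℝ, ContDiff ℝ ∞ g ∧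
      ∀ φ, IsTest Q φ → IsTest Q ((PolyCap.partialDeriv i)^[n] φ) ∧
        ∫ x, f x * (PolyCap.partialDeriv i)^[n] φ x = (-1) ^ n * ∫ x, g x * φ x := by
  induction n with
  | zero => intro f hf; exact ⟨f, hf, fun φ h => ⟨h, by simp⟩⟩
  | succ n ih =>
    intro f hf
    obtain ⟨g, hg, H⟩ := ih f hf
    refine ⟨PolyCap.partialDeriv i g,
      (hg.fderiv_right (m := ∞) (by simp)).clm_apply contDiff_const, fun φ h => ?_⟩
    obtain ⟨h1, h2⟩ := H _ (h.partialDeriv i)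
    rw [Function.iterate_succ_apply]
    refine ⟨h1, ?_⟩
    rw [h2, partialDeriv_byParts hg h i]
    ring

theorem list_byParts (Q : Cube N) (γ : Fin N → ℕ) (l : List (Fin N)) :
    ∀ f : (Fin N → ℝ) → ℝ, ContDiff ℝ ∞ f → ∃ g : (Fin N → ℝ) → ℝ, ContDiff ℝ ∞ g ∧
      ∀ φ, IsTest Q φ →
        IsTest Q (l.foldr (fun i ψ => (PolyCap.partialDeriv i)^[γ i] ψ) φ) ∧
        ∫ x, f x * l.foldr (fun i ψ => (PolyCap.partialDeriv i)^[γ i] ψ) φ x =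
          (-1) ^ (l.map γ).sum * ∫ x, g x * φ x := by
  induction l with
  | nil => intro f hf; exact ⟨f, hf, fun φ h => ⟨h, by simp⟩⟩
  | cons i l ih =>
    intro f hf
    obtain ⟨g, hg, H⟩ := iterate_byParts Q i (γ i) f hf
    obtain ⟨g', hg', H'⟩ := ih g hg
    refine ⟨g', hg', fun φ h => ?_⟩
    obtain ⟨h1, h2⟩ := H' φ h
    obtain ⟨h3, h4⟩ := H _ h1
    refine ⟨h3, ?_⟩
    rw [List.foldr_cons, h4, h2, List.map_cons, List.sum_cons, pow_add]
    ring

theorem IsTest.multiDeriv {Q : Cube N} {φ : (Fin N → ℝ) → ℝ} (h : IsTest Q φ) (γ : Fin N → ℕ) :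
    IsTest Q (multiDeriv γ φ) := by
  obtain ⟨g, -, H⟩ := list_byParts Q γ (List.finRange N) 0 contDiff_const
  exact (H φ h).1

theorem IsTest.setIntegral {Q : Cube N} {φ : (Fin N → ℝ) → ℝ} (h : IsTest Q φ)
    (f : (Fin N → ℝ) → ℝ) : ∫ x in Q.toSet, f x * φ x = ∫ x, f x * φ x := by
  refine setIntegral_eq_integral_of_forall_compl_eq_zero fun x hx => ?_
  rw [image_eq_zero_of_notMem_tsupport fun hx' => hx (h.2.2 hx'), mul_zero]

theorem IsTest.integrable_mul {Q : Cube N} {φ : (Fin N → ℝ) → ℝ} (h : IsTest Q φ) {p : ℝ≥0∞}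
    (hp : 1 ≤ p) (u : Lp ℝ p Q.vol) : Integrable (fun x => u x * φ x) Q.vol := by
  obtain ⟨C, hC⟩ := h.2.1.exists_bound_of_continuous h.1.continuous
  exact ((Lp.memLp u).integrable hp).mul_bdd (c := C) h.1.continuous.aestronglyMeasurable
    (Filter.Eventually.of_forall hC)

/-- Every polynomial has weak derivatives of all orders in `L^p(Q)`. -/
theorem exists_isWeakDeriv_polyLp (Q : Cube N) (p : ℝ≥0∞) (γ : Fin N → ℕ)
    (P : MvPolynomial (Fin N) ℝ) : ∃ v, IsWeakDeriv Q γ (polyLp Q p P) v := by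
  have hP : ContDiff ℝ ∞ fun x : Fin N → ℝ => MvPolynomial.eval x P := by
    induction P using MvPolynomial.induction_on with
    | C a => simpa using contDiff_const
    | add P R hP hR => simpa using hP.add hR
    | mul_X P i hP => simpa using hP.mul (contDiff_apply ℝ ℝ i)
  obtain ⟨g, hg, H⟩ := list_byParts Q γ (List.finRange N) _ hP
  have hgp : MemLp g p Q.vol := by
    obtain ⟨C, hC⟩ := (isCompact_closedBall Q.center (Q.side / 2)).exists_bound_of_continuousOn
      hg.continuous.continuousOn
    refine MemLp.of_bound hg.continuous.aestronglyMeasurable C ?_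
    refine (ae_restrict_iff' Q.isOpen.measurableSet).2 (Filter.Eventually.of_forall fun x hx => ?_)
    rw [Q.toSet_eq_ball] at hx
    exact hC x (Metric.ball_subset_closedBall hx)
  refine ⟨hgp.toLp g, fun φ h => ?_⟩
  have e1 : ∫ x in Q.toSet, polyLp Q p P x * multiDeriv γ φ x =
      ∫ x in Q.toSet, MvPolynomial.eval x P * multiDeriv γ φ x := by
    refine integral_congr_ae ?_
    filter_upwards [(memLp_poly Q p P).coeFn_toLp] with x hx
    rw [polyLp, hx]
  have e2 : ∫ x in Q.toSet, hgp.toLp g x * φ x = ∫ x in Q.toSet, g x * φ x := by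
    refine integral_congr_ae ?_
    filter_upwards [hgp.coeFn_toLp] with x hx
    rw [hx]
  have e3 : order γ = ((List.finRange N).map γ).sum := by
    rw [order, ← List.ofFn_eq_map, List.sum_ofFn]
  rw [e1, e2, (h.multiDeriv γ).setIntegral, h.setIntegral, e3]
  exact (H φ h).2

theorem IsWeakDeriv.unique {Q : Cube N} {p : ℝ≥0∞} (hp : 1 ≤ p) {γ : Fin N → ℕ}
    {u v w : Lp ℝ p Q.vol} (hv : IsWeakDeriv Q γ u v) (hw : IsWeakDeriv Q γ u w) : v = w := by
  have hvi : Integrable v Q.vol := (Lp.memLp v).integrable hp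
  have hwi : Integrable w Q.vol := (Lp.memLp w).integrable hp
  have key := Q.isOpen.ae_eq_zero_of_integral_contDiff_smul_eq_zero (μ := volume)
    (f := fun x => v x - w x)
    (IntegrableOn.locallyIntegrableOn (hvi.sub hwi)) (fun φ h1 h2 h3 => by
      have h : IsTest Q φ := ⟨h1, h2, h3⟩
      have e := (hv φ h).symm.trans (hw φ h)
      have e' := mul_left_cancel₀ (pow_ne_zero _ (by norm_num)) e
      have : ∫ x, φ x • (v x - w x) = ∫ x in Q.toSet, (v x - w x) * φ x := by
        rw [h.setIntegral]; simp only [smul_eq_mul, mul_comm]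
      rw [this]
      simp only [sub_mul]
      rw [integral_sub (h.integrable_mul hp v) (h.integrable_mul hp w), e', sub_self])
  refine Lp.ext ((ae_restrict_iff' Q.isOpen.measurableSet).2 ?_)
  filter_upwards [key] with x hx hxQ
  exact sub_eq_zero.1 (hx hxQ)

theorem weakDeriv_eq {Q : Cube N} {p : ℝ≥0∞} (hp : 1 ≤ p) {γ : Fin N → ℕ}
    {u v : Lp ℝ p Q.vol} (hv : IsWeakDeriv Q γ u v) : weakDeriv Q γ u = v := by
  have h : ∃ v : Lp ℝ p Q.vol, IsWeakDeriv Q γ u v := ⟨v, hv⟩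
  rw [weakDeriv, dif_pos h]
  exact h.choose_spec.unique hp hv

theorem IsWeakDeriv.add_smul {Q : Cube N} {p : ℝ≥0∞} (hp : 1 ≤ p) {γ : Fin N → ℕ}
    {u v u' v' : Lp ℝ p Q.vol} (h : IsWeakDeriv Q γ u v) (h' : IsWeakDeriv Q γ u' v') (c : ℝ) :
    IsWeakDeriv Q γ (u + c • u') (v + c • v') := by
  have aux : ∀ (a b : Lp ℝ p Q.vol) (φ : (Fin N → ℝ) → ℝ), IsTest Q φ →
      ∫ x in Q.toSet, (a + c • b : Lp ℝ p Q.vol) x * φ x =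
        (∫ x in Q.toSet, a x * φ x) + c * ∫ x in Q.toSet, b x * φ x := by
    intro a b φ hφ
    rw [← integral_const_mul, ← integral_add (hφ.integrable_mul hp a)
      ((hφ.integrable_mul hp b).const_mul c)]
    refine integral_congr_ae ?_
    filter_upwards [Lp.coeFn_add a (c • b), Lp.coeFn_smul c b] with x h1 h2
    rw [h1, Pi.add_apply, h2, Pi.smul_apply, smul_eq_mul]
    ring
  intro φ hφ
  rw [aux _ _ _ (hφ.multiDeriv γ), aux _ _ _ hφ, h φ hφ, h' φ hφ]
  ring

theorem polyLp_add_smul (Q : Cube N) (p : ℝ≥0∞) (P R : MvPolynomial (Fin N) ℝ) (c : ℝ) :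
    polyLp Q p (P + c • R) = polyLp Q p P + c • polyLp Q p R := by
  rw [polyLp, polyLp, polyLp, ← MemLp.toLp_const_smul, ← MemLp.toLp_add]
  congr 1
  ext x
  simp [MvPolynomial.smul_eval]

/-- The minimizers `Π_{r,r,p} u` exist. -/
theorem exists_isProjection (Q : Cube N) (p : ℝ≥0∞) (hp : 1 ≤ p) :
    ∃ Proj : ℕ → Lp ℝ p Q.vol → MvPolynomial (Fin N) ℝ, IsProjection Q p Proj := by
  classical
  have : Fact (1 ≤ p) := ⟨hp⟩
  suffices H : ∀ (r : ℕ) (u : Lp ℝ p Q.vol), ∃ P : MvPolynomial (Fin N) ℝ,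
      u ∈ sobolev Q (r + 1) p → IsBestPoly Q r u P by
    choose Proj h using H
    exact ⟨Proj, h⟩
  intro r u
  by_cases hu : u ∈ sobolev Q (r + 1) p
  swap
  · exact ⟨0, fun h => absurd h hu⟩
  let V := MvPolynomial.restrictTotalDegree (Fin N) ℝ r
  let I := Σ i : Fin (r + 1), {β // β ∈ Finset.piAntidiag (Finset.univ : Finset (Fin N)) (i : ℕ)}
  let L (β : Fin N → ℕ) : MvPolynomial (Fin N) ℝ →ₗ[ℝ] Lp ℝ p Q.vol :=
    IsLinearMap.mk' (fun P => weakDeriv Q β (polyLp Q p P)) (by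
      have h (P R : MvPolynomial (Fin N) ℝ) (c : ℝ) :
          weakDeriv Q β (polyLp Q p (P + c • R)) =
            weakDeriv Q β (polyLp Q p P) + c • weakDeriv Q β (polyLp Q p R) := by
        obtain ⟨v, hv⟩ := exists_isWeakDeriv_polyLp Q p β P
        obtain ⟨w, hw⟩ := exists_isWeakDeriv_polyLp Q p β R
        rw [weakDeriv_eq hp hv, weakDeriv_eq hp hw, polyLp_add_smul]
        exact weakDeriv_eq hp (hv.add_smul hp hw c)
      have h0 : weakDeriv Q β (polyLp Q p 0) = 0 := by simpa using h 0 0 1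
      exact ⟨fun P R => by simpa using h P R 1, fun c R => by simpa [h0] using h 0 R c⟩)
  let F : V →ₗ[ℝ] PiLp 1 (fun _ : I => Lp ℝ p Q.vol) :=
    (WithLp.linearEquiv 1 ℝ (I → Lp ℝ p Q.vol)).symm.toLinearMap ∘ₗ
      LinearMap.pi fun j => (L j.2.1) ∘ₗ V.subtype
  let u0 : PiLp 1 (fun _ : I => Lp ℝ p Q.vol) := WithLp.toLp 1 fun j => weakDeriv Q j.2.1 u
  have hF : ∀ P : V, ‖u0 - F P‖ =
      ∑ i ∈ Finset.range (r + 1), gradNorm Q i (u - polyLp Q p (P : MvPolynomial (Fin N) ℝ)) := by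
    intro P
    rw [PiLp.norm_eq_of_L1, Fintype.sum_sigma, Finset.sum_range]
    refine Finset.sum_congr rfl fun i _ => ?_
    rw [gradNorm, ← Finset.sum_coe_sort (Finset.piAntidiag (Finset.univ : Finset (Fin N)) (i : ℕ))
      (fun β => ‖weakDeriv Q β (u - polyLp Q p (P : MvPolynomial (Fin N) ℝ))‖)]
    refine Finset.sum_congr rfl fun β _ => ?_
    have hβ : order β.1 ≤ r + 1 := by
      have := (Finset.mem_piAntidiag.1 β.2).1
      rw [order, this]; omega
    obtain ⟨v, hv⟩ := hu β.1 hβ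
    obtain ⟨w, hw⟩ := exists_isWeakDeriv_polyLp Q p β.1 (P : MvPolynomial (Fin N) ℝ)
    have e := weakDeriv_eq hp (hv.add_smul hp hw (-1))
    rw [neg_one_smul, neg_one_smul, ← sub_eq_add_neg, ← sub_eq_add_neg] at e
    rw [e, ← weakDeriv_eq hp hv, ← weakDeriv_eq hp hw]
    rfl
  have hproper : ProperSpace (LinearMap.range F) := FiniteDimensional.proper_real _
  obtain ⟨⟨w, P, rfl⟩, hw⟩ := Continuous.exists_forall_le
    (f := fun w : LinearMap.range F => ‖u0 - w‖) (by fun_prop) (by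
      refine Filter.tendsto_atTop_mono (f := fun w : LinearMap.range F => ‖w‖ - ‖u0‖) (fun w => ?_)
        (Filter.tendsto_atTop_add_const_right _ _ (tendsto_norm_cocompact_atTop))
      have := norm_sub_norm_le (w : PiLp 1 (fun _ : I => Lp ℝ p Q.vol)) u0
      rw [norm_sub_rev] at this
      exact this)
  refine ⟨P, fun _ => ⟨(MvPolynomial.mem_restrictTotalDegree _ _ _).1 P.2, fun R hR => ?_⟩⟩
  have := hw ⟨_, ⟨R, (MvPolynomial.mem_restrictTotalDegree _ _ _).2 hR⟩, rfl⟩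
  rw [← hF P, ← hF ⟨R, (MvPolynomial.mem_restrictTotalDegree _ _ _).2 hR⟩]
  exact this

end PolyCap

end

noncomputable section

namespace PolyCap

variable {N : ℕ}

/-! Fix an admissible `u`, let `P` be its best polynomial and `L` the norm of the low part of `P`.
If the norm of `∇^m u` exceeds `ε * L`, the quotient of `u` is at least `ε ^ p`; since every
capacity is at most 1, any `γ` and `δ` will do.

Otherwise `P` is close to `u` with all derivatives of order below `m`: by the Deny–Lions estimate
(`exists_poly_sum_gradNorm_le`, an iteration of the Poincaré inequality) and minimality of `P`, the
error is at most `η * L` with `η` small. The low part of `P` has a coefficient, at some `β` with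
`|β| ≤ k`, comparable to `L` (`exists_coeff_ge_lowNorm`). For `γ ≤ β` this coefficient survives in
`D^γ P` at `β - γ`, and also in the best polynomial `R` of `D^γ u`, because `R` and `D^γ P` both
approximate `D^γ u` within `η * L`. So the part of `R` of degree at most `k'` is comparable to `L`
as soon as `|β| - |γ| ≤ k'`, while all of `R` is bounded by a multiple of `L` because the
complementary part of `P` is at most `L / α`. Thus `D^γ u` is admissible with a new `α'`
(`exists_weakDeriv_admissible`), and its quotient is at most a constant times that of `u`.

If `s ≤ |β|`, take `γ ≤ β` of order `s` and `k' = k - s`; if `|β| ≤ s`, take `δ = β` and `k' = 0`.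
The pair depends on `u`, but only finitely many pairs occur, so one that minimizes the smaller of
the two capacities serves every `u`. -/

/-! ### Multi-indices and commuting classical derivatives -/

theorem order_zero : order (0 : Fin N → ℕ) = 0 := by simp [order]

theorem order_add (γ β : Fin N → ℕ) : order (γ + β) = order γ + order β := by
  simp [order, Finset.sum_add_distrib]

theorem order_single (i : Fin N) (n : ℕ) : order (Pi.single i n) = n := by
  simp [order]

theorem order_eq_zero_iff {γ : Fin N → ℕ} : order γ = 0 ↔ γ = 0 := by
  simp [order, funext_iff]

theorem multiIndex_induction {motive : (Fin N → ℕ) → Prop} (zero : motive 0)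
    (step : ∀ β i, motive β → motive (β + Pi.single i 1)) (β : Fin N → ℕ) : motive β := by
  induction h : order β generalizing β with
  | zero => rw [order_eq_zero_iff.1 h]; exact zero
  | succ n ih =>
    obtain ⟨i, hi⟩ : ∃ i, β i ≠ 0 := by
      by_contra! hc
      rw [order_eq_zero_iff.2 (funext hc)] at h
      omega
    have e : β - Pi.single i 1 + Pi.single i 1 = β := by
      refine tsub_add_cancel_of_le fun j => ?_
      rcases eq_or_ne j i with rfl | hj
      · simp; omega
      · simp [hj]
    have h2 := order_add (β - Pi.single i 1) (Pi.single i 1)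
    rw [e, order_single] at h2
    rw [← e]
    exact step _ _ (ih _ (by omega))

theorem contDiff_partialDeriv {φ : (Fin N → ℝ) → ℝ} (h : ContDiff ℝ ∞ φ) (i : Fin N) :
    ContDiff ℝ ∞ (partialDeriv i φ) :=
  (h.fderiv_right (m := ∞) (by simp)).clm_apply contDiff_const

theorem partialDeriv_comm {φ : (Fin N → ℝ) → ℝ} (h : ContDiff ℝ ∞ φ) (i j : Fin N) :
    partialDeriv i (partialDeriv j φ) = partialDeriv j (partialDeriv i φ) := by
  have hd : Differentiable ℝ (fderiv ℝ φ) :=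
    (h.fderiv_right (m := ∞) (by simp)).differentiable (by simp)
  have key (a b : Fin N) (x : Fin N → ℝ) : partialDeriv a (partialDeriv b φ) x =
      fderiv ℝ (fderiv ℝ φ) x (Pi.single a 1) (Pi.single b 1) := by
    unfold partialDeriv
    rw [fderiv_clm_apply (hd x) (differentiableAt_const _)]
    simp
  ext x
  rw [key, key]
  refine (h.contDiffAt.isSymmSndFDerivAt ?_) _ _
  rw [minSmoothness_of_isRCLikeNormedField]
  exact WithTop.coe_le_coe.2 (le_top : (2 : ℕ∞) ≤ ⊤)

theorem contDiff_iterate_partialDeriv {φ : (Fin N → ℝ) → ℝ} (h : ContDiff ℝ ∞ φ) (i : Fin N)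
    (n : ℕ) : ContDiff ℝ ∞ ((partialDeriv i)^[n] φ) := by
  induction n generalizing φ with
  | zero => exact h
  | succ n ih => exact ih (contDiff_partialDeriv h i)

theorem partialDeriv_iterate_comm {φ : (Fin N → ℝ) → ℝ} (h : ContDiff ℝ ∞ φ) (i j : Fin N)
    (n : ℕ) : partialDeriv i ((partialDeriv j)^[n] φ) = (partialDeriv j)^[n] (partialDeriv i φ) := by
  induction n generalizing φ with
  | zero => rfl
  | succ n ih =>
    rw [Function.iterate_succ_apply, Function.iterate_succ_apply,
      ih (contDiff_partialDeriv h j), partialDeriv_comm h]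

theorem contDiff_foldr_partialDeriv {φ : (Fin N → ℝ) → ℝ} (h : ContDiff ℝ ∞ φ)
    (γ : Fin N → ℕ) (l : List (Fin N)) :
    ContDiff ℝ ∞ (l.foldr (fun i ψ => (partialDeriv i)^[γ i] ψ) φ) := by
  induction l with
  | nil => exact h
  | cons j l ih => exact contDiff_iterate_partialDeriv ih j _

theorem partialDeriv_foldr_comm {φ : (Fin N → ℝ) → ℝ} (h : ContDiff ℝ ∞ φ) (i : Fin N)
    (γ : Fin N → ℕ) (l : List (Fin N)) :
    partialDeriv i (l.foldr (fun i ψ => (partialDeriv i)^[γ i] ψ) φ) =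
      l.foldr (fun i ψ => (partialDeriv i)^[γ i] ψ) (partialDeriv i φ) := by
  induction l with
  | nil => rfl
  | cons j l ih =>
    rw [List.foldr_cons, List.foldr_cons,
      partialDeriv_iterate_comm (contDiff_foldr_partialDeriv h γ l), ih]

/-- A duplicate-free list meets `i` at most once, so the extra derivative is applied at most once;
symmetry of second derivatives carries it inwards to `φ`. -/
theorem foldr_partialDeriv_add_single {φ : (Fin N → ℝ) → ℝ} (h : ContDiff ℝ ∞ φ) (i : Fin N)
    (γ : Fin N → ℕ) (l : List (Fin N)) (hl : l.Nodup) :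
    l.foldr (fun j ψ => (partialDeriv j)^[(γ + Pi.single i 1 : Fin N → ℕ) j] ψ) φ =
      l.foldr (fun j ψ => (partialDeriv j)^[γ j] ψ) (if i ∈ l then partialDeriv i φ else φ) := by
  induction l with
  | nil => simp
  | cons j l ih =>
    obtain ⟨hj, hl⟩ := List.nodup_cons.1 hl
    rw [List.foldr_cons, List.foldr_cons, ih hl]
    rcases eq_or_ne i j with rfl | hij
    · rw [if_neg hj, if_pos (List.mem_cons_self ..), Pi.add_apply, Pi.single_eq_same,
        Function.iterate_succ_apply, partialDeriv_foldr_comm h]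
    · simp [hij, hij.symm]

theorem multiDeriv_zero (φ : (Fin N → ℝ) → ℝ) : multiDeriv 0 φ = φ := by
  simp [multiDeriv]

theorem multiDeriv_add_single {φ : (Fin N → ℝ) → ℝ} (h : ContDiff ℝ ∞ φ) (γ : Fin N → ℕ)
    (i : Fin N) : multiDeriv (γ + Pi.single i 1) φ = multiDeriv γ (partialDeriv i φ) := by
  have := foldr_partialDeriv_add_single h i γ _ (List.nodup_finRange N)
  rwa [if_pos (List.mem_finRange i)] at this

theorem multiDeriv_single {φ : (Fin N → ℝ) → ℝ} (h : ContDiff ℝ ∞ φ) (i : Fin N) :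
    multiDeriv (Pi.single i 1) φ = partialDeriv i φ := by
  have := multiDeriv_add_single h 0 i
  rwa [zero_add, multiDeriv_zero] at this

theorem multiDeriv_add {φ : (Fin N → ℝ) → ℝ} (h : ContDiff ℝ ∞ φ) (γ β : Fin N → ℕ) :
    multiDeriv (γ + β) φ = multiDeriv γ (multiDeriv β φ) := by
  induction β using multiIndex_induction generalizing φ with
  | zero => rw [add_zero, multiDeriv_zero]
  | step β i ih =>
    rw [← add_assoc, multiDeriv_add_single h, multiDeriv_add_single h,
      ih (contDiff_partialDeriv h i)]

/-! ### Calculus of weak derivatives -/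

section WeakDeriv

variable {Q : Cube N} {p : ℝ≥0∞}

theorem IsWeakDeriv.zero_right (u : Lp ℝ p Q.vol) : IsWeakDeriv Q 0 u u := by
  intro φ _
  simp [multiDeriv_zero, order_zero]

theorem IsWeakDeriv.comp {γ β : Fin N → ℕ} {u v w : Lp ℝ p Q.vol}
    (h : IsWeakDeriv Q γ u v) (h' : IsWeakDeriv Q β v w) : IsWeakDeriv Q (γ + β) u w := by
  intro φ hφ
  rw [multiDeriv_add hφ.1, h _ (hφ.multiDeriv β), h' φ hφ, order_add, pow_add, mul_assoc]

/-- The derivative `multiDeriv β φ` is itself a test function for `h`, and the common sign cancels.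
This is what puts derivatives of Sobolev functions back into Sobolev spaces. -/
theorem IsWeakDeriv.of_add {γ β : Fin N → ℕ} {u v w : Lp ℝ p Q.vol}
    (h : IsWeakDeriv Q γ u v) (h' : IsWeakDeriv Q (γ + β) u w) : IsWeakDeriv Q β v w := by
  intro φ hφ
  have h1 := h' φ hφ
  rw [multiDeriv_add hφ.1, h _ (hφ.multiDeriv β), order_add, pow_add, mul_assoc] at h1
  exact mul_left_cancel₀ (pow_ne_zero _ (by norm_num)) h1

theorem IsWeakDeriv.sub (hp : 1 ≤ p) {γ : Fin N → ℕ} {u v u' v' : Lp ℝ p Q.vol}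
    (h : IsWeakDeriv Q γ u v) (h' : IsWeakDeriv Q γ u' v') : IsWeakDeriv Q γ (u - u') (v - v') := by
  have := h.add_smul hp h' (-1)
  rwa [neg_one_smul, neg_one_smul, ← sub_eq_add_neg, ← sub_eq_add_neg] at this

theorem isWeakDeriv_weakDeriv {m : ℕ} {u : Lp ℝ p Q.vol} (hu : u ∈ sobolev Q m p)
    {γ : Fin N → ℕ} (hγ : order γ ≤ m) : IsWeakDeriv Q γ u (weakDeriv Q γ u) := by
  have h := hu γ hγ
  rw [weakDeriv, dif_pos h]
  exact h.choose_spec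

theorem weakDeriv_zero (hp : 1 ≤ p) (u : Lp ℝ p Q.vol) : weakDeriv Q 0 u = u :=
  weakDeriv_eq hp (IsWeakDeriv.zero_right u)

theorem weakDeriv_weakDeriv (hp : 1 ≤ p) {m : ℕ} {u : Lp ℝ p Q.vol} (hu : u ∈ sobolev Q m p)
    {γ β : Fin N → ℕ} (h : order γ + order β ≤ m) :
    weakDeriv Q β (weakDeriv Q γ u) = weakDeriv Q (γ + β) u :=
  weakDeriv_eq hp ((isWeakDeriv_weakDeriv hu (by omega)).of_add
    (isWeakDeriv_weakDeriv hu (by rwa [order_add])))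

theorem weakDeriv_sub (hp : 1 ≤ p) {m : ℕ} {u v : Lp ℝ p Q.vol} (hu : u ∈ sobolev Q m p)
    (hv : v ∈ sobolev Q m p) {γ : Fin N → ℕ} (h : order γ ≤ m) :
    weakDeriv Q γ (u - v) = weakDeriv Q γ u - weakDeriv Q γ v :=
  weakDeriv_eq hp ((isWeakDeriv_weakDeriv hu h).sub hp (isWeakDeriv_weakDeriv hv h))

theorem sobolev_sub (hp : 1 ≤ p) {m : ℕ} {u v : Lp ℝ p Q.vol} (hu : u ∈ sobolev Q m p)
    (hv : v ∈ sobolev Q m p) : u - v ∈ sobolev Q m p := fun _ hγ =>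
  ⟨_, (isWeakDeriv_weakDeriv hu hγ).sub hp (isWeakDeriv_weakDeriv hv hγ)⟩

theorem sobolev_anti {m n : ℕ} (h : n ≤ m) : sobolev Q m p ⊆ sobolev Q n p :=
  fun _ hu γ hγ => hu γ (hγ.trans h)

theorem weakDeriv_mem_sobolev {m n : ℕ} {u : Lp ℝ p Q.vol} (hu : u ∈ sobolev Q m p)
    {γ : Fin N → ℕ} (h : order γ + n ≤ m) : weakDeriv Q γ u ∈ sobolev Q n p := fun β hβ =>
  ⟨weakDeriv Q (γ + β) u, (isWeakDeriv_weakDeriv hu (by omega)).of_add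
    (isWeakDeriv_weakDeriv hu (by rw [order_add]; omega))⟩

theorem polyLp_mem_sobolev (Q : Cube N) (p : ℝ≥0∞) (m : ℕ) (P : MvPolynomial (Fin N) ℝ) :
    polyLp Q p P ∈ sobolev Q m p := fun γ _ => exists_isWeakDeriv_polyLp Q p γ P

theorem mem_piAntidiag_iff_order {j : ℕ} {β : Fin N → ℕ} :
    β ∈ Finset.piAntidiag (Finset.univ : Finset (Fin N)) j ↔ order β = j := by
  simp [order]

theorem gradNorm_nonneg (j : ℕ) (u : Lp ℝ p Q.vol) : 0 ≤ gradNorm Q j u :=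
  Finset.sum_nonneg fun _ _ => ENNReal.toReal_nonneg

theorem norm_weakDeriv_le_gradNorm {γ : Fin N → ℕ} (u : Lp ℝ p Q.vol) :
    ‖weakDeriv Q γ u‖ ≤ gradNorm Q (order γ) u :=
  Finset.single_le_sum (f := fun β => ‖weakDeriv Q β u‖) (fun _ _ => ENNReal.toReal_nonneg)
    (mem_piAntidiag_iff_order.2 rfl)

theorem gradNorm_zero (hp : 1 ≤ p) (u : Lp ℝ p Q.vol) : gradNorm Q 0 u = ‖u‖ := by
  have : Finset.piAntidiag (Finset.univ : Finset (Fin N)) 0 = {0} := by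
    ext β; simp only [mem_piAntidiag_iff_order, order_eq_zero_iff, Finset.mem_singleton]
  rw [gradNorm, this, Finset.sum_singleton, weakDeriv_zero hp]

/-- The map `β ↦ γ + β` is injective, so the left side is a partial sum of the right. -/
theorem gradNorm_weakDeriv_le (hp : 1 ≤ p) {m j : ℕ} {u : Lp ℝ p Q.vol}
    (hu : u ∈ sobolev Q m p) {γ : Fin N → ℕ} (h : order γ + j ≤ m) :
    gradNorm Q j (weakDeriv Q γ u) ≤ gradNorm Q (order γ + j) u := by
  classical
  rw [gradNorm, gradNorm]
  calc _ = ∑ β ∈ Finset.piAntidiag (Finset.univ : Finset (Fin N)) j, ‖weakDeriv Q (γ + β) u‖ :=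
        Finset.sum_congr rfl fun β hβ => by
          rw [weakDeriv_weakDeriv hp hu (by rw [mem_piAntidiag_iff_order.1 hβ]; exact h)]
    _ = ∑ β ∈ (Finset.piAntidiag (Finset.univ : Finset (Fin N)) j).image (γ + ·),
          ‖weakDeriv Q β u‖ := by
          rw [Finset.sum_image fun _ _ _ _ e => add_left_cancel e]
    _ ≤ _ := by
      refine Finset.sum_le_sum_of_subset_of_nonneg ?_ fun _ _ _ => ENNReal.toReal_nonneg
      intro β hβ
      obtain ⟨η, hη, rfl⟩ := Finset.mem_image.1 hβ
      rw [mem_piAntidiag_iff_order] at hη ⊢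
      rw [order_add, hη]

end WeakDeriv

/-! ### Weak derivatives of polynomials -/

section Poly

theorem contDiff_evalPoly (P : MvPolynomial (Fin N) ℝ) :
    ContDiff ℝ ∞ fun x : Fin N → ℝ => MvPolynomial.eval x P := by
  induction P using MvPolynomial.induction_on with
  | C a => simpa using contDiff_const
  | add P R hP hR => simpa using hP.add hR
  | mul_X P i hP => simpa using hP.mul (contDiff_apply ℝ ℝ i)

theorem partialDeriv_evalPoly (i : Fin N) (P : MvPolynomial (Fin N) ℝ) :
    partialDeriv i (fun x => MvPolynomial.eval x P) =
      fun x => MvPolynomial.eval x (MvPolynomial.pderiv i P) := by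
  have hd (R : MvPolynomial (Fin N) ℝ) :
      Differentiable ℝ fun x : Fin N → ℝ => MvPolynomial.eval x R :=
    (contDiff_evalPoly R).differentiable (by simp)
  ext x
  unfold partialDeriv
  induction P using MvPolynomial.induction_on with
  | C a => simp
  | add P R hP hR =>
    simp only [map_add]
    rw [fderiv_fun_add (hd P x) (hd R x), add_apply, hP, hR]
  | mul_X P j hP =>
    simp only [map_mul, MvPolynomial.eval_X]
    have hj : HasFDerivAt (fun x : Fin N → ℝ => x j)
        (ContinuousLinearMap.proj (R := ℝ) (φ := fun _ : Fin N => ℝ) j) x :=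
      hasFDerivAt_apply j x
    rw [fderiv_fun_mul (hd P x) hj.differentiableAt, hj.fderiv]
    simp only [add_apply, smul_apply, hP,
      Derivation.leibniz, MvPolynomial.pderiv_X, smul_eq_mul, map_add, map_mul,
      MvPolynomial.eval_X, ContinuousLinearMap.proj_apply]
    rcases eq_or_ne j i with rfl | hji
    · simp
    · simp [hji]

theorem isWeakDeriv_single_polyLp (Q : Cube N) (p : ℝ≥0∞) (i : Fin N)
    (P : MvPolynomial (Fin N) ℝ) :
    IsWeakDeriv Q (Pi.single i 1) (polyLp Q p P) (polyLp Q p (MvPolynomial.pderiv i P)) := by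
  have e (R : MvPolynomial (Fin N) ℝ) {ψ : (Fin N → ℝ) → ℝ} (hψ : IsTest Q ψ) :
      ∫ x in Q.toSet, polyLp Q p R x * ψ x = ∫ x, MvPolynomial.eval x R * ψ x := by
    rw [← hψ.setIntegral]
    refine integral_congr_ae ?_
    filter_upwards [(memLp_poly Q p R).coeFn_toLp] with x hx
    rw [polyLp, hx]
  intro φ hφ
  rw [multiDeriv_single hφ.1, e _ (hφ.partialDeriv i), e _ hφ,
    partialDeriv_byParts (contDiff_evalPoly P) hφ, partialDeriv_evalPoly, order_single]
  simp

/-- Differentiation shifts coefficients and multiplies them by positive integers. Only `1 ≤ c μ`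
matters later: no surviving coefficient shrinks. -/
theorem exists_polyDeriv (Q : Cube N) (p : ℝ≥0∞) (β : Fin N → ℕ) :
    ∃ (D : MvPolynomial (Fin N) ℝ →ₗ[ℝ] MvPolynomial (Fin N) ℝ) (c : (Fin N →₀ ℕ) → ℝ),
      (∀ μ, 1 ≤ c μ) ∧
      (∀ P μ, (D P).coeff μ = c μ * P.coeff (μ + Finsupp.equivFunOnFinite.symm β)) ∧
      ∀ P, IsWeakDeriv Q β (polyLp Q p P) (polyLp Q p (D P)) := by
  induction β using multiIndex_induction with
  | zero =>
    refine ⟨LinearMap.id, fun _ => 1, fun _ => le_rfl, fun P μ => ?_,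
      fun P => IsWeakDeriv.zero_right _⟩
    have : Finsupp.equivFunOnFinite.symm (0 : Fin N → ℕ) = 0 := by ext; simp
    simp [this]
  | step β i ih =>
    obtain ⟨D, c, hc, hD, hw⟩ := ih
    refine ⟨(MvPolynomial.pderiv i).toLinearMap ∘ₗ D,
      fun μ => c (μ + Finsupp.single i 1) * (μ i + 1), fun μ => ?_, fun P μ => ?_, fun P => ?_⟩
    · exact one_le_mul_of_one_le_of_one_le (hc _) (by simp)
    · have e : Finsupp.equivFunOnFinite.symm (β + Pi.single i 1 : Fin N → ℕ) =
          Finsupp.single i 1 + Finsupp.equivFunOnFinite.symm β := by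
        ext j; simp [Finsupp.single_apply, Pi.single_apply, eq_comm, add_comm]
      rw [LinearMap.comp_apply, Derivation.coeFn_coe, e, ← add_assoc,
        MvPolynomial.coeff_pderiv, hD]
      ring
    · exact (hw P).comp (isWeakDeriv_single_polyLp Q p i (D P))

end Poly

/-! ### The Poincaré inequality on a cube -/

section Poincare

theorem fderiv_apply_eq_sum_partialDeriv (φ : (Fin N → ℝ) → ℝ) (z h : Fin N → ℝ) :
    fderiv ℝ φ z h = ∑ i, h i * partialDeriv i φ z := by
  conv_lhs => rw [pi_eq_sum_univ' h]
  rw [map_sum]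
  refine Finset.sum_congr rfl fun i _ => ?_
  rw [map_smul, smul_eq_mul, partialDeriv]

theorem Cube.convex (Q : Cube N) : Convex ℝ Q.toSet := by
  rw [Q.toSet_eq_ball]; exact convex_ball _ _

/-- By convexity of the cube, the segment from `x` to `x + h` stays in `Q` when both ends do. -/
theorem isTest_translate {Q : Cube N} {φ : (Fin N → ℝ) → ℝ} {h : Fin N → ℝ}
    (h1 : ContDiff ℝ ∞ φ) (h2 : HasCompactSupport φ)
    (h3 : tsupport φ ⊆ {x | x ∈ Q.toSet ∧ x + h ∈ Q.toSet}) {t : ℝ} (ht : t ∈ Set.Icc (0 : ℝ) 1) :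
    IsTest Q fun y => φ (y - t • h) := by
  refine ⟨h1.comp (contDiff_id.sub contDiff_const),
    h2.comp_homeomorph (Homeomorph.subRight (t • h)), ?_⟩
  have e : tsupport (fun y => φ (y - t • h)) = (Homeomorph.subRight (t • h)) ⁻¹' tsupport φ :=
    tsupport_comp_eq_preimage φ (Homeomorph.subRight (t • h))
  rw [e]
  intro y hy
  obtain ⟨ha, hb⟩ := h3 hy
  have := Q.convex.add_smul_mem ha hb ht
  simpa using this

theorem integrable_prod_translate {G : (Fin N → ℝ) → ℝ} (hG : Integrable G)
    (hGm : StronglyMeasurable G) (h : Fin N → ℝ) :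
    Integrable (fun z : (Fin N → ℝ) × ℝ => G (z.1 + z.2 • h))
      (volume.prod (volume.restrict (Set.Ioc (0 : ℝ) 1))) := by
  have hm : Measurable fun z : (Fin N → ℝ) × ℝ => z.1 + z.2 • h := by fun_prop
  refine (integrable_prod_iff' (hGm.comp_measurable hm).aestronglyMeasurable).2 ⟨Filter.Eventually.of_forall fun t => hG.comp_add_right (t • h), ?_⟩
  have (t : ℝ) : ∫ x, ‖G (x + t • h)‖ = ∫ x, ‖G x‖ :=
    integral_add_right_eq_self (fun x => ‖G x‖) (t • h)
  simp only [Function.comp_def, this]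
  exact integrable_const _

theorem integral_fderiv_segment {φ : (Fin N → ℝ) → ℝ} (h1 : ContDiff ℝ ∞ φ) (y h : Fin N → ℝ) :
    ∫ t in Set.Ioc (0 : ℝ) 1, fderiv ℝ φ (y - t • h) h = φ y - φ (y - h) := by
  have hd : ∀ t : ℝ, HasDerivAt (fun t : ℝ => - φ (y - t • h)) (fderiv ℝ φ (y - t • h) h) t := by
    intro t
    have e1 : HasDerivAt (fun t : ℝ => y - t • h) (-h) t := by
      simpa using ((hasDerivAt_id t).smul_const h).const_sub y
    have e2 := ((h1.differentiable (by simp)) (y - t • h)).hasFDerivAt.comp_hasDerivAt t e1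
    have e3 := e2.neg
    rw [map_neg, neg_neg] at e3
    exact e3
  have hc : Continuous fun t : ℝ => fderiv ℝ φ (y - t • h) h :=
    ((h1.continuous_fderiv (by simp)).comp (by fun_prop)).clm_apply continuous_const
  rw [← intervalIntegral.integral_of_le zero_le_one,
    intervalIntegral.integral_eq_sub_of_hasDerivAt (fun t _ => hd t) (hc.intervalIntegrable _ _)]
  simp only [one_smul, zero_smul, sub_zero]
  ring

/-- A weakly differentiable function is, along almost every segment in a given direction, the
integral of its weak gradient. -/
theorem ae_sub_translate_eq_integral (Q : Cube N) {u : (Fin N → ℝ) → ℝ}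
    {g : Fin N → (Fin N → ℝ) → ℝ} (hu : Integrable u) (hg : ∀ i, Integrable (g i))
    (hgm : ∀ i, StronglyMeasurable (g i))
    (hw : ∀ φ, IsTest Q φ → ∀ i, ∫ x, u x * partialDeriv i φ x = - ∫ x, g i x * φ x)
    (h : Fin N → ℝ) :
    ∀ᵐ x, x ∈ {x | x ∈ Q.toSet ∧ x + h ∈ Q.toSet} →
      u (x + h) - u x = ∫ t in Set.Ioc (0 : ℝ) 1, ∑ i, h i * g i (x + t • h) := by
  set G : (Fin N → ℝ) → ℝ := fun x => ∑ i, h i * g i x with hGdef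
  have hG : Integrable G := integrable_finsetSum _ fun i _ => (hg i).const_mul _
  have hGm : StronglyMeasurable G :=
    Finset.stronglyMeasurable_fun_sum _ fun i _ => (hgm i).const_mul _
  have hG2 := integrable_prod_translate hG hGm h
  have hf3 : Integrable fun x => ∫ t in Set.Ioc (0 : ℝ) 1, G (x + t • h) := hG2.integral_prod_left
  have hf1 : Integrable fun x => u (x + h) := hu.comp_add_right h
  have hopen : IsOpen {x | x ∈ Q.toSet ∧ x + h ∈ Q.toSet} :=
    Q.isOpen.inter (Q.isOpen.preimage (by fun_prop))
  have key := hopen.ae_eq_zero_of_integral_contDiff_smul_eq_zero (μ := volume)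
    (f := fun x => u (x + h) - u x - ∫ t in Set.Ioc (0 : ℝ) 1, G (x + t • h))
    (((hf1.sub hu).sub hf3).locallyIntegrable.locallyIntegrableOn _) ?_
  · filter_upwards [key] with x hx hxQ
    exact sub_eq_zero.1 (hx hxQ)
  intro φ h1 h2 h3
  obtain ⟨C, hC⟩ := h2.exists_bound_of_continuous h1.continuous
  have hfc : Continuous fun z => fderiv ℝ φ z h :=
    (h1.continuous_fderiv (by simp)).clm_apply continuous_const
  obtain ⟨C', hC'⟩ := (h2.fderiv_apply (𝕜 := ℝ) h).exists_bound_of_continuous hfc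
  have hφm (f : (Fin N → ℝ) → ℝ) (hf : Integrable f) : Integrable fun x => f x * φ x :=
    hf.mul_bdd h1.continuous.aestronglyMeasurable (Filter.Eventually.of_forall hC)
  -- For fixed `t`, move the translation onto `φ`; the translate is a test function in `Q`, so the
  -- weak derivative identity applies.
  have hslice : ∀ t ∈ Set.Ioc (0 : ℝ) 1, ∫ x, G (x + t • h) * φ x =
      - ∫ y, u y * fderiv ℝ φ (y - t • h) h := by
    intro t ht
    have hT := isTest_translate h1 h2 h3 (Set.Ioc_subset_Icc_self ht)
    have e1 : ∫ x, G (x + t • h) * φ x = ∫ y, G y * φ (y - t • h) := by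
      rw [← integral_add_right_eq_self (fun y => G y * φ (y - t • h)) (t • h)]
      simp
    obtain ⟨C1, hC1⟩ := hT.2.1.exists_bound_of_continuous hT.1.continuous
    have hpd (i : Fin N) (y : Fin N → ℝ) :
        partialDeriv i (fun y => φ (y - t • h)) y = partialDeriv i φ (y - t • h) := by
      rw [partialDeriv, fderiv_comp_sub, partialDeriv]
    rw [e1]
    simp only [hGdef, fderiv_apply_eq_sum_partialDeriv, Finset.sum_mul, Finset.mul_sum]
    rw [integral_finsetSum, integral_finsetSum, ← Finset.sum_neg_distrib]
    · refine Finset.sum_congr rfl fun i _ => ?_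
      have := hw _ hT i
      simp only [hpd] at this
      simp only [mul_assoc, mul_left_comm _ (h i)]
      rw [integral_const_mul, integral_const_mul, this]
      ring
    · intro i _
      have hTi := hT.partialDeriv i
      obtain ⟨C2, hC2⟩ := hTi.2.1.exists_bound_of_continuous hTi.1.continuous
      have := (hu.mul_bdd hTi.1.continuous.aestronglyMeasurable
        (Filter.Eventually.of_forall hC2)).const_mul (h i)
      refine this.congr (Filter.Eventually.of_forall fun y => ?_)
      simp only [hpd]
      ring
    · intro i _
      exact ((hg i).const_mul (h i)).mul_bdd hT.1.continuous.aestronglyMeasurable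
        (Filter.Eventually.of_forall hC1)
  -- Fubini brings the `t`-integral inside, where it is the integral of a derivative along a
  -- segment.
  have hthird : ∫ x, (∫ t in Set.Ioc (0 : ℝ) 1, G (x + t • h)) * φ x =
      (∫ x, u (x + h) * φ x) - ∫ x, u x * φ x := by
    simp only [← integral_mul_const]
    rw [integral_integral_swap, setIntegral_congr_fun measurableSet_Ioc hslice, integral_neg,
      integral_integral_swap]
    · simp only [integral_const_mul, integral_fderiv_segment h1]
      have e : ∫ x, u (x + h) * φ x = ∫ y, u y * φ (y - h) := by
        rw [← integral_add_right_eq_self (fun y => u y * φ (y - h)) h]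
        simp
      rw [e, ← integral_neg, ← integral_sub]
      · congr 1; ext y; ring
      · refine hu.mul_bdd (c := C) (h1.continuous.comp (by fun_prop)).aestronglyMeasurable
          (Filter.Eventually.of_forall fun y => hC _)
      · exact hφm u hu
    · have i1 : Integrable (fun z : ℝ × (Fin N → ℝ) => u z.2)
          ((volume.restrict (Set.Ioc (0 : ℝ) 1)).prod volume) := hu.comp_snd _
      exact i1.mul_bdd (c := C') (hfc.comp (by fun_prop)).aestronglyMeasurable
        (Filter.Eventually.of_forall fun z => hC' _)
    · exact hG2.mul_bdd (c := C) (h1.continuous.comp continuous_fst).aestronglyMeasurable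
        (Filter.Eventually.of_forall fun z => hC _)
  have hsplit : ∀ x, φ x • (u (x + h) - u x - ∫ t in Set.Ioc (0 : ℝ) 1, G (x + t • h)) =
      u (x + h) * φ x - u x * φ x - (∫ t in Set.Ioc (0 : ℝ) 1, G (x + t • h)) * φ x := by
    intro x; rw [smul_eq_mul]; ring
  simp only [hsplit]
  have hs1 : Integrable fun x => u (x + h) * φ x - u x * φ x := (hφm _ hf1).sub (hφm u hu)
  rw [integral_sub hs1 (hφm _ hf3), integral_sub (hφm _ hf1) (hφm u hu),
    hthird, sub_self]

/-- Jensen's inequality, read off from the monotonicity of `L^q` norms on a probability space. -/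
theorem lintegral_rpow_le_of_isProbabilityMeasure {X : Type*} [MeasurableSpace X] (ν : Measure X)
    [IsProbabilityMeasure ν] {f : X → ℝ} (hf : AEStronglyMeasurable f ν) {q : ℝ} (hq : 1 ≤ q) :
    (∫⁻ t, ‖f t‖ₑ ∂ν) ^ q ≤ ∫⁻ t, ‖f t‖ₑ ^ q ∂ν := by
  have h := eLpNorm'_le_eLpNorm'_of_exponent_le one_pos hq ν hf
  have hq0 : 0 < q := by linarith
  simp only [eLpNorm', ENNReal.rpow_one, div_one] at h
  rwa [← ENNReal.rpow_le_rpow_iff (z := q⁻¹) (by positivity), ENNReal.rpow_rpow_inv hq0.ne',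
    ← one_div]

/-- The `L^q` modulus of continuity of a weakly differentiable function. -/
theorem lintegral_sub_translate_le (Q : Cube N) {u : (Fin N → ℝ) → ℝ}
    {g : Fin N → (Fin N → ℝ) → ℝ} (hu : Integrable u) (hg : ∀ i, Integrable (g i))
    (hgm : ∀ i, StronglyMeasurable (g i))
    (hw : ∀ φ, IsTest Q φ → ∀ i, ∫ x, u x * partialDeriv i φ x = - ∫ x, g i x * φ x)
    (h : Fin N → ℝ) {q : ℝ} (hq : 1 ≤ q) :
    ∫⁻ x in {x | x ∈ Q.toSet ∧ x + h ∈ Q.toSet}, ‖u (x + h) - u x‖ₑ ^ q ≤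
      ‖h‖ₑ ^ q * ∫⁻ x, ‖∑ i, ‖g i x‖‖ₑ ^ q := by
  have hq0 : 0 ≤ q := by linarith
  set S : (Fin N → ℝ) → ℝ := fun x => ∑ i, ‖g i x‖ with hS
  have hSm : StronglyMeasurable S := Finset.stronglyMeasurable_fun_sum _ fun i _ => (hgm i).norm
  have hmeas : MeasurableSet {x | x ∈ Q.toSet ∧ x + h ∈ Q.toSet} :=
    (Q.isOpen.inter (Q.isOpen.preimage (by fun_prop : Continuous fun x => x + h))).measurableSet
  have hprob : IsProbabilityMeasure (volume.restrict (Set.Ioc (0 : ℝ) 1)) := ⟨by simp⟩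
  have hGS (y : Fin N → ℝ) : ‖∑ i, h i * g i y‖ₑ ≤ ‖h‖ₑ * ‖S y‖ₑ := by
    have hle : ‖∑ i, h i * g i y‖ ≤ ‖h‖ * ‖S y‖ := by
      have hS0 : 0 ≤ S y := Finset.sum_nonneg fun i _ => norm_nonneg _
      rw [Real.norm_of_nonneg hS0, hS, Finset.mul_sum]
      refine norm_sum_le_of_le _ fun i _ => ?_
      rw [norm_mul]
      exact mul_le_mul_of_nonneg_right (norm_le_pi_norm h i) (norm_nonneg _)
    rw [← ofReal_norm, ← ofReal_norm, ← ofReal_norm, ← ENNReal.ofReal_mul (norm_nonneg _)]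
    exact ENNReal.ofReal_le_ofReal hle
  calc ∫⁻ x in {x | x ∈ Q.toSet ∧ x + h ∈ Q.toSet}, ‖u (x + h) - u x‖ₑ ^ q
      ≤ ∫⁻ x in {x | x ∈ Q.toSet ∧ x + h ∈ Q.toSet},
          ‖h‖ₑ ^ q * ∫⁻ t in Set.Ioc (0 : ℝ) 1, ‖S (x + t • h)‖ₑ ^ q := by
        refine lintegral_mono_ae ((ae_restrict_iff' hmeas).2 ?_)
        filter_upwards [ae_sub_translate_eq_integral Q hu hg hgm hw h] with x hx hxQ
        rw [hx hxQ]
        calc _ ≤ (∫⁻ t in Set.Ioc (0 : ℝ) 1, ‖h‖ₑ * ‖S (x + t • h)‖ₑ) ^ q := by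
              refine ENNReal.rpow_le_rpow ((enorm_integral_le_lintegral_enorm _).trans ?_) hq0
              exact lintegral_mono fun t => hGS _
          _ = ‖h‖ₑ ^ q * (∫⁻ t in Set.Ioc (0 : ℝ) 1, ‖S (x + t • h)‖ₑ) ^ q := by
              rw [lintegral_const_mul' _ _ enorm_ne_top, ENNReal.mul_rpow_of_nonneg _ _ hq0]
          _ ≤ _ := by
              gcongr
              exact lintegral_rpow_le_of_isProbabilityMeasure _
                (hSm.comp_measurable (by fun_prop)).aestronglyMeasurable hq
    _ ≤ ∫⁻ x, ‖h‖ₑ ^ q * ∫⁻ t in Set.Ioc (0 : ℝ) 1, ‖S (x + t • h)‖ₑ ^ q :=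
        setLIntegral_le_lintegral _ _
    _ = ‖h‖ₑ ^ q * ∫⁻ t in Set.Ioc (0 : ℝ) 1, ∫⁻ x, ‖S (x + t • h)‖ₑ ^ q := by
        rw [lintegral_const_mul' _ _ (ENNReal.rpow_ne_top_of_nonneg hq0 enorm_ne_top),
          lintegral_lintegral_swap]
        exact ((hSm.comp_measurable (g := fun z : (Fin N → ℝ) × ℝ => z.1 + z.2 • h)
          (by fun_prop)).enorm.pow_const q).aemeasurable
    _ = ‖h‖ₑ ^ q * ∫⁻ x, ‖S x‖ₑ ^ q := by
        have (t : ℝ) := lintegral_add_right_eq_self (μ := volume) (fun x => ‖S x‖ₑ ^ q) (t • h)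
        simp [this]

/-- Integrate `|u x - u y| ^ q` over `Q × Q`. With `x = h + y`, the inner integral is controlled by
the `L^q` modulus of continuity, and only `h` in a ball contribute. The constant is a value `u y` at
a point where the integral in `x` does not exceed its average. -/
theorem exists_lintegral_sub_const_le (Q : Cube N) {q : ℝ} (hq : 1 ≤ q) :
    ∃ A : ℝ≥0∞, A ≠ ⊤ ∧ ∀ (u : (Fin N → ℝ) → ℝ) (g : Fin N → (Fin N → ℝ) → ℝ),
      Integrable u → StronglyMeasurable u → (∀ i, Integrable (g i)) →
      (∀ i, StronglyMeasurable (g i)) →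
      (∀ φ, IsTest Q φ → ∀ i, ∫ x, u x * partialDeriv i φ x = - ∫ x, g i x * φ x) →
      ∃ c : ℝ, ∫⁻ x in Q.toSet, ‖u x - c‖ₑ ^ q ≤ A * ∫⁻ x, ‖∑ i, ‖g i x‖‖ₑ ^ q := by
  have hq0 : 0 ≤ q := by linarith
  have hQ0 : volume Q.toSet ≠ 0 :=
    (Q.isOpen.measure_pos volume ⟨Q.center, by simp [Cube.toSet, Q.side_pos]⟩).ne'
  have hQt : volume Q.toSet ≠ ⊤ := by rw [Q.toSet_eq_ball]; exact measure_ball_lt_top.ne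
  set B : Set (Fin N → ℝ) := Metric.ball 0 Q.side
  refine ⟨(volume Q.toSet)⁻¹ * (volume B * ENNReal.ofReal Q.side ^ q), ?_, ?_⟩
  · exact ENNReal.mul_ne_top (ENNReal.inv_ne_top.2 hQ0) (ENNReal.mul_ne_top measure_ball_lt_top.ne
      (ENNReal.rpow_ne_top_of_nonneg hq0 ENNReal.ofReal_ne_top))
  intro u g hu hum hg hgm hw
  set I := ∫⁻ x, ‖∑ i, ‖g i x‖‖ₑ ^ q
  let Φ : (Fin N → ℝ) × (Fin N → ℝ) → ℝ≥0∞ :=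
    (Q.toSet ×ˢ Q.toSet).indicator fun z => ‖u z.1 - u z.2‖ₑ ^ q
  have hF : Measurable fun z : (Fin N → ℝ) × (Fin N → ℝ) => ‖u z.1 - u z.2‖ₑ ^ q :=
    ((hum.measurable.comp measurable_fst).sub (hum.measurable.comp measurable_snd)).enorm.pow_const q
  have hΦ : Measurable Φ := hF.indicator (Q.isOpen.measurableSet.prod Q.isOpen.measurableSet)
  have hdouble : ∫⁻ y in Q.toSet, ∫⁻ x in Q.toSet, ‖u x - u y‖ₑ ^ q ≤
      volume B * ENNReal.ofReal Q.side ^ q * I := by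
    calc _ = ∫⁻ y, ∫⁻ x, Φ (x, y) := by
          rw [← lintegral_indicator Q.isOpen.measurableSet]
          refine lintegral_congr fun y => ?_
          by_cases hy : y ∈ Q.toSet
          · rw [Set.indicator_of_mem hy, ← lintegral_indicator Q.isOpen.measurableSet]
            refine lintegral_congr fun x => ?_
            by_cases hx : x ∈ Q.toSet <;> simp [Φ, hx, hy]
          · simp [Φ, hy]
      _ = ∫⁻ y, ∫⁻ h, Φ (h + y, y) := by
          refine lintegral_congr fun y => ?_
          exact (lintegral_add_right_eq_self (fun x => Φ (x, y)) y).symm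
      _ = ∫⁻ h, ∫⁻ y, Φ (h + y, y) := by
          refine lintegral_lintegral_swap (Measurable.aemeasurable ?_)
          exact hΦ.comp (by fun_prop : Measurable fun z : (Fin N → ℝ) × (Fin N → ℝ) =>
            (z.2 + z.1, z.1))
      _ ≤ ∫⁻ h, B.indicator (fun _ => ENNReal.ofReal Q.side ^ q * I) h := by
          refine lintegral_mono fun h => ?_
          have hmeas : MeasurableSet {x | x ∈ Q.toSet ∧ x + h ∈ Q.toSet} :=
            (Q.isOpen.inter (Q.isOpen.preimage
              (by fun_prop : Continuous fun x => x + h))).measurableSet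
          have e : ∫⁻ y, Φ (h + y, y) =
              ∫⁻ x in {x | x ∈ Q.toSet ∧ x + h ∈ Q.toSet}, ‖u (x + h) - u x‖ₑ ^ q := by
            rw [← lintegral_indicator hmeas]
            refine lintegral_congr fun y => ?_
            by_cases hy : y ∈ {x | x ∈ Q.toSet ∧ x + h ∈ Q.toSet}
            · rw [Set.indicator_of_mem hy, add_comm h]
              exact Set.indicator_of_mem (s := Q.toSet ×ˢ Q.toSet) ⟨hy.2, hy.1⟩ _
            · rw [Set.indicator_of_notMem hy, add_comm h]
              exact Set.indicator_of_notMem (s := Q.toSet ×ˢ Q.toSet)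
                (fun hc => hy ⟨hc.2, hc.1⟩) _
          rw [e]
          by_cases hh : h ∈ B
          · rw [Set.indicator_of_mem hh]
            refine (lintegral_sub_translate_le Q hu hg hgm hw h hq).trans ?_
            gcongr
            rw [← ofReal_norm]
            exact ENNReal.ofReal_le_ofReal (mem_ball_zero_iff.1 hh).le
          -- Two points of `Q` differ by less than the side length in the sup norm.
          · have : {x | x ∈ Q.toSet ∧ x + h ∈ Q.toSet} = ∅ := by
              refine Set.eq_empty_of_forall_notMem fun x hx => hh ?_
              obtain ⟨h1, h2⟩ := hx
              rw [Q.toSet_eq_ball] at h1 h2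
              rw [mem_ball_zero_iff]
              have := dist_triangle_right (x + h) x Q.center
              rw [Metric.mem_ball] at h1 h2
              rw [dist_eq_norm, add_sub_cancel_left] at this
              linarith
            rw [this]
            simp
      _ = _ := by
          rw [lintegral_indicator_const measurableSet_ball]
          ring
  obtain ⟨y, -, hy⟩ := exists_le_setLAverage (μ := volume) (s := Q.toSet)
    (f := fun y => ∫⁻ x in Q.toSet, ‖u x - u y‖ₑ ^ q) hQ0 hQt
    (Measurable.aemeasurable (Measurable.lintegral_prod_left' hF))
  refine ⟨u y, hy.trans ?_⟩
  rw [setLAverage_eq, ENNReal.div_eq_inv_mul, mul_assoc]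
  gcongr

/-- The Poincaré inequality on a cube. -/
theorem exists_norm_sub_const_le (Q : Cube N) {p : ℝ≥0∞} (hp : 1 ≤ p) (hp_top : p ≠ ⊤) :
    ∃ K : ℝ, 0 ≤ K ∧ ∀ (u : Lp ℝ p Q.vol) (g : Fin N → Lp ℝ p Q.vol),
      (∀ i, IsWeakDeriv Q (Pi.single i 1) u (g i)) →
      ∃ c : ℝ, ‖u - polyLp Q p (MvPolynomial.C c)‖ ≤ K * ∑ i, ‖g i‖ := by
  have hp0 : p ≠ 0 := (zero_lt_one.trans_le hp).ne'
  have hq : 1 ≤ p.toReal := by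
    rw [← ENNReal.toReal_one]; exact ENNReal.toReal_mono hp_top hp
  have hq0 : 0 < p.toReal := by linarith
  have hQm := Q.isOpen.measurableSet
  obtain ⟨A, hA, H⟩ := exists_lintegral_sub_const_le Q hq
  refine ⟨(A ^ (1 / p.toReal)).toReal, ENNReal.toReal_nonneg, fun u g hug => ?_⟩
  -- The preceding estimate concerns functions on the whole space, so everything is extended by
  -- zero; test functions supported in `Q` do not see the extension.
  have hint (v : Lp ℝ p Q.vol) : Integrable (Q.toSet.indicator v) :=
    (integrable_indicator_iff hQm).2 ((Lp.memLp v).integrable hp)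
  have hmeas (v : Lp ℝ p Q.vol) : StronglyMeasurable (Q.toSet.indicator v) :=
    (Lp.stronglyMeasurable v).indicator hQm
  have htest (v : Lp ℝ p Q.vol) {ψ : (Fin N → ℝ) → ℝ} (hψ : IsTest Q ψ) :
      ∫ x, Q.toSet.indicator v x * ψ x = ∫ x in Q.toSet, v x * ψ x := by
    rw [← hψ.setIntegral]
    exact setIntegral_congr_fun hQm fun x hx => by simp only [Set.indicator_of_mem hx]
  obtain ⟨c, hc⟩ := H (Q.toSet.indicator u) (fun i => Q.toSet.indicator (g i)) (hint u) (hmeas u)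
    (fun i => hint _) (fun i => hmeas _) (fun φ hφ i => by
      rw [htest u (hφ.partialDeriv i), htest (g i) hφ, ← multiDeriv_single hφ.1, hug i φ hφ,
        order_single]
      simp)
  refine ⟨c, ?_⟩
  have e1 : eLpNorm (u - polyLp Q p (MvPolynomial.C c) : Lp ℝ p Q.vol) p Q.vol =
      (∫⁻ x in Q.toSet, ‖Q.toSet.indicator u x - c‖ₑ ^ p.toReal) ^ (1 / p.toReal) := by
    rw [eLpNorm_eq_lintegral_rpow_enorm_toReal hp0 hp_top]
    congr 1
    refine lintegral_congr_ae ?_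
    filter_upwards [Lp.coeFn_sub u (polyLp Q p (MvPolynomial.C c)),
      (memLp_poly Q p (MvPolynomial.C c)).coeFn_toLp, ae_restrict_mem hQm] with x h1 h2 h3
    rw [h1, Pi.sub_apply, polyLp, h2, Set.indicator_of_mem h3, MvPolynomial.eval_C]
  have e2 : (∫⁻ x, ‖∑ i, ‖Q.toSet.indicator (g i) x‖‖ₑ ^ p.toReal) ^ (1 / p.toReal) ≤
      ∑ i, eLpNorm (g i) p Q.vol := by
    rw [← eLpNorm_eq_lintegral_rpow_enorm_toReal hp0 hp_top]
    have h1 := eLpNorm_sum_le (μ := (volume : Measure (Fin N → ℝ)))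
      (f := fun (i : Fin N) x => ‖Q.toSet.indicator (g i) x‖) (s := Finset.univ)
      (fun i _ => (hmeas (g i)).norm.aestronglyMeasurable) hp
    have h2 : (∑ i : Fin N, fun x => ‖Q.toSet.indicator (g i) x‖) =
        fun x => ∑ i, ‖Q.toSet.indicator (g i) x‖ := by
      ext x; simp
    rw [h2] at h1
    refine h1.trans (Finset.sum_le_sum fun i _ => ?_)
    rw [eLpNorm_norm, eLpNorm_indicator_eq_eLpNorm_restrict hQm]
  have hfin (i : Fin N) : eLpNorm (g i) p Q.vol ≠ ⊤ := (Lp.memLp (g i)).2.ne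
  have h3 : eLpNorm (u - polyLp Q p (MvPolynomial.C c) : Lp ℝ p Q.vol) p Q.vol ≤
      A ^ (1 / p.toReal) * ∑ i, eLpNorm (g i) p Q.vol := by
    rw [e1]
    refine (ENNReal.rpow_le_rpow hc (by positivity)).trans ?_
    rw [ENNReal.mul_rpow_of_nonneg _ _ (by positivity)]
    gcongr
  have h4 := ENNReal.toReal_mono (ENNReal.mul_ne_top
    (ENNReal.rpow_ne_top_of_nonneg (by positivity) hA) (ENNReal.sum_ne_top.2 fun i _ => hfin i)) h3
  rw [ENNReal.toReal_mul, ENNReal.toReal_sum fun i _ => hfin i] at h4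
  simpa only [Lp.norm_def] using h4

end Poincare

/-! ### Norms on polynomials of bounded degree -/

section FiniteDimension

theorem degree_toFinsupp (β : Fin N → ℕ) :
    Finsupp.degree (Finsupp.equivFunOnFinite.symm β) = order β := by
  simp [Finsupp.degree_eq_sum, order]

theorem order_coe (μ : Fin N →₀ ℕ) : order (μ : Fin N → ℕ) = Finsupp.degree μ := by
  simp [Finsupp.degree_eq_sum, order]

theorem totalDegree_le_iff_coeff {P : MvPolynomial (Fin N) ℝ} {r : ℕ} :
    P.totalDegree ≤ r ↔ ∀ μ : Fin N →₀ ℕ, r < Finsupp.degree μ → P.coeff μ = 0 := by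
  refine ⟨fun h μ hμ => MvPolynomial.coeff_eq_zero_of_totalDegree_lt (h.trans_lt hμ),
    fun h => Finset.sup_le fun μ hμ => ?_⟩
  by_contra! hc
  exact (MvPolynomial.mem_support_iff.1 hμ) (h μ hc)

variable {p : ℝ≥0∞}

/-- The map `polyLp`, as a linear map. -/
def polyLin (Q : Cube N) (p : ℝ≥0∞) : MvPolynomial (Fin N) ℝ →ₗ[ℝ] Lp ℝ p Q.vol :=
  IsLinearMap.mk' (polyLp Q p) (by
    have h0 : polyLp Q p 0 = 0 := by simpa using polyLp_add_smul Q p 0 0 1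
    exact ⟨fun P R => by simpa using polyLp_add_smul Q p P R 1,
      fun c R => by simpa [h0] using polyLp_add_smul Q p 0 R c⟩)

theorem polyLin_apply (Q : Cube N) (p : ℝ≥0∞) (P : MvPolynomial (Fin N) ℝ) :
    polyLin Q p P = polyLp Q p P := rfl

theorem polyLp_zero (Q : Cube N) (p : ℝ≥0∞) : polyLp Q p 0 = 0 := (polyLin Q p).map_zero

theorem polyLp_add (Q : Cube N) (p : ℝ≥0∞) (P R : MvPolynomial (Fin N) ℝ) :
    polyLp Q p (P + R) = polyLp Q p P + polyLp Q p R := (polyLin Q p).map_add P R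

theorem polyLp_sub (Q : Cube N) (p : ℝ≥0∞) (P R : MvPolynomial (Fin N) ℝ) :
    polyLp Q p (P - R) = polyLp Q p P - polyLp Q p R := (polyLin Q p).map_sub P R

/-- By continuity the polynomial vanishes everywhere on `Q`, a product of infinite sets. -/
theorem eq_zero_of_polyLp_eq_zero {Q : Cube N} {P : MvPolynomial (Fin N) ℝ}
    (h : polyLp Q p P = 0) : P = 0 := by
  have h1 : (fun x => MvPolynomial.eval x P) =ᵐ[Q.vol] fun _ => 0 := by
    filter_upwards [(memLp_poly Q p P).coeFn_toLp, Lp.coeFn_zero ℝ p Q.vol] with x hx hx0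
    rw [← hx]
    change polyLp Q p P x = 0
    rw [h, hx0]
    rfl
  have h2 := Measure.eqOn_open_of_ae_eq h1 Q.isOpen (continuous_evalPoly P).continuousOn
    continuousOn_const
  refine MvPolynomial.funext_set (fun i => Set.Ioo (Q.center i - Q.side / 2)
    (Q.center i + Q.side / 2)) (fun i => Set.Ioo_infinite (by linarith [Q.side_pos]))
    fun x hx => ?_
  rw [map_zero]
  refine h2 fun i => ?_
  have := hx i (Set.mem_univ i)
  rw [abs_lt]
  constructor <;> linarith [this.1, this.2]

/-- The `L^p(Q)` norm is a norm on the finite-dimensional space of polynomials of degree at most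
`r`, where every linear map is bounded. -/
theorem exists_norm_map_le [Fact (1 ≤ p)] (Q : Cube N) (r : ℕ) {F : Type*}
    [NormedAddCommGroup F] [NormedSpace ℝ F] (L : MvPolynomial (Fin N) ℝ →ₗ[ℝ] F) :
    ∃ K : ℝ, ∀ P : MvPolynomial (Fin N) ℝ, P.totalDegree ≤ r → ‖L P‖ ≤ K * ‖polyLp Q p P‖ := by
  let V := MvPolynomial.restrictTotalDegree (Fin N) ℝ r
  let T : V →ₗ[ℝ] Lp ℝ p Q.vol := polyLin Q p ∘ₗ V.subtype
  have hT : Function.Injective T := by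
    refine (injective_iff_map_eq_zero T).2 fun P hP => ?_
    exact Subtype.ext (eq_zero_of_polyLp_eq_zero (Q := Q) (p := p) hP)
  let e := LinearEquiv.ofInjective T hT
  let M : LinearMap.range T →L[ℝ] F :=
    LinearMap.toContinuousLinearMap ((L ∘ₗ V.subtype) ∘ₗ e.symm.toLinearMap)
  refine ⟨‖M‖, fun P hP => ?_⟩
  let P' : V := ⟨P, (MvPolynomial.mem_restrictTotalDegree _ _ _).2 hP⟩
  have h1 : M (e P') = L P := by
    change L (V.subtype (e.symm (e P'))) = L P
    rw [e.symm_apply_apply]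
    rfl
  have h2 := M.le_opNorm (e P')
  rw [h1] at h2
  exact h2

/-- Merges finitely many constants into one; it is made positive so that it can be divided by. -/
theorem exists_uniform_bound {ι X : Type*} (s : Finset ι) (S : Set X) {f : ι → X → ℝ} {b : X → ℝ}
    (hb : ∀ x, 0 ≤ b x) (h : ∀ i, ∃ K, ∀ x ∈ S, f i x ≤ K * b x) :
    ∃ K, 0 < K ∧ ∀ i ∈ s, ∀ x ∈ S, f i x ≤ K * b x := by
  choose K hK using h
  refine ⟨∑ i ∈ s, |K i| + 1, by positivity, fun i hi x hx => (hK i x hx).trans ?_⟩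
  refine mul_le_mul_of_nonneg_right ?_ (hb x)
  have := Finset.single_le_sum (f := fun i => |K i|) (fun _ _ => abs_nonneg _) hi
  linarith [le_abs_self (K i)]

/-- `lowPart`, as a linear map. -/
def lowLin (k : ℕ) : MvPolynomial (Fin N) ℝ →ₗ[ℝ] MvPolynomial (Fin N) ℝ :=
  ∑ i ∈ Finset.range (k + 1), MvPolynomial.homogeneousComponent i

theorem lowLin_apply (k : ℕ) (P : MvPolynomial (Fin N) ℝ) : lowLin k P = lowPart k P := by
  simp [lowLin, lowPart]

theorem coeff_lowPart (k : ℕ) (P : MvPolynomial (Fin N) ℝ) (μ : Fin N →₀ ℕ) :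
    (lowPart k P).coeff μ = if Finsupp.degree μ ≤ k then P.coeff μ else 0 := by
  simp [lowPart, MvPolynomial.coeff_sum, MvPolynomial.coeff_homogeneousComponent,
    Finset.sum_ite_eq]

theorem mem_Iic_of_order_le {γ : Fin N → ℕ} {m : ℕ} (h : order γ ≤ m) :
    γ ∈ Finset.Iic (fun _ : Fin N => m) :=
  Finset.mem_Iic.2 fun i =>
    (Finset.single_le_sum (f := γ) (fun _ _ => Nat.zero_le _) (Finset.mem_univ i)).trans h

/-- Expand the low part in monomials and bound every coefficient by the largest one. Summing over a
box of exponents that depends only on `m` makes `c` independent of `k`. -/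
theorem exists_coeff_ge_lowNorm [Fact (1 ≤ p)] (Q : Cube N) (m : ℕ) :
    ∃ c : ℝ, 0 < c ∧ ∀ (k : ℕ) (P : MvPolynomial (Fin N) ℝ), k ≤ m → lowNorm Q p k P ≠ 0 →
      ∃ β : Fin N → ℕ, order β ≤ k ∧
        c * lowNorm Q p k P ≤ |P.coeff (Finsupp.equivFunOnFinite.symm β)| := by
  classical
  let w : (Fin N → ℕ) → ℝ := fun β =>
    ‖polyLp Q p (MvPolynomial.monomial (Finsupp.equivFunOnFinite.symm β) 1)‖
  let I := Finset.Iic (fun _ : Fin N => m)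
  have hW : 0 ≤ ∑ β ∈ I, w β := Finset.sum_nonneg fun _ _ => norm_nonneg _
  have hpos : 0 < ∑ β ∈ I, w β + 1 := add_pos_of_nonneg_of_pos hW one_pos
  refine ⟨(∑ β ∈ I, w β + 1)⁻¹, inv_pos.2 hpos, fun k P hk hP => ?_⟩
  set R := lowPart k P with hR
  have hR0 : R.support.Nonempty := by
    rw [Finset.nonempty_iff_ne_empty, Ne, MvPolynomial.support_eq_empty]
    intro h0
    exact hP (by rw [lowNorm, ← hR, h0, polyLp_zero, norm_zero])
  obtain ⟨μ, hμ, hmax⟩ := Finset.exists_max_image R.support (fun ν => |R.coeff ν|) hR0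
  have hdeg : ∀ ν ∈ R.support, Finsupp.degree ν ≤ k ∧ R.coeff ν = P.coeff ν := by
    intro ν hν
    have := MvPolynomial.mem_support_iff.1 hν
    rw [hR, coeff_lowPart] at this ⊢
    split_ifs with h
    · exact ⟨h, rfl⟩
    · simp [h] at this
  refine ⟨μ, ?_, ?_⟩
  · rw [order_coe]; exact (hdeg μ hμ).1
  rw [Finsupp.equivFunOnFinite_symm_coe, ← (hdeg μ hμ).2, inv_mul_le_iff₀ hpos]
  have hsupp : R.support ⊆ I.image Finsupp.equivFunOnFinite.symm := by
    intro ν hν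
    have h1 : (ν : Fin N → ℕ) ∈ I :=
      mem_Iic_of_order_le ((order_coe ν).le.trans ((hdeg ν hν).1.trans hk))
    have h2 := Finset.mem_image_of_mem Finsupp.equivFunOnFinite.symm h1
    rwa [Finsupp.equivFunOnFinite_symm_coe] at h2
  calc lowNorm Q p k P = ‖polyLin Q p R‖ := rfl
    _ = ‖∑ ν ∈ R.support, R.coeff ν • polyLp Q p (MvPolynomial.monomial ν 1)‖ := by
        conv_lhs => rw [R.as_sum]
        rw [map_sum]
        congr 1
        refine Finset.sum_congr rfl fun ν _ => ?_
        rw [← polyLin_apply, ← map_smul, MvPolynomial.smul_monomial, smul_eq_mul, mul_one]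
    _ ≤ ∑ ν ∈ R.support, |R.coeff μ| * ‖polyLp Q p (MvPolynomial.monomial ν 1)‖ := by
        refine norm_sum_le_of_le _ fun ν hν => ?_
        rw [norm_smul]
        exact mul_le_mul_of_nonneg_right (hmax ν hν) (norm_nonneg _)
    _ ≤ ∑ ν ∈ I.image Finsupp.equivFunOnFinite.symm,
          |R.coeff μ| * ‖polyLp Q p (MvPolynomial.monomial ν 1)‖ :=
        Finset.sum_le_sum_of_subset_of_nonneg hsupp fun _ _ _ =>
          mul_nonneg (abs_nonneg _) (norm_nonneg _)
    _ = (∑ β ∈ I, w β) * |R.coeff μ| := by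
        rw [Finset.sum_image fun _ _ _ _ h => Finsupp.equivFunOnFinite.symm.injective h,
          ← Finset.mul_sum, mul_comm]
    _ ≤ (∑ β ∈ I, w β + 1) * |R.coeff μ| :=
        mul_le_mul_of_nonneg_right (le_add_of_nonneg_right zero_le_one) (abs_nonneg _)

end FiniteDimension

/-! ### Polynomial approximation in Sobolev spaces -/

section Approximation

variable {p : ℝ≥0∞} [Fact (1 ≤ p)]

/-- Poincaré applied to each `D^β u` with `|β| = n` gives a constant `a β`. These constants can be
prescribed independently: on a homogeneous polynomial of degree `n`, `D^β` sees only the coefficient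
at `β`. -/
theorem exists_poly_weakDeriv_near (Q : Cube N) (hp_top : p ≠ ⊤) (n : ℕ) :
    ∃ K : ℝ, 0 ≤ K ∧ ∀ u ∈ sobolev Q (n + 1) p, ∃ P : MvPolynomial (Fin N) ℝ,
      (∀ μ, n < Finsupp.degree μ → P.coeff μ = 0) ∧
      gradNorm Q n (u - polyLp Q p P) ≤ K * gradNorm Q (n + 1) u := by
  classical
  have hp : 1 ≤ p := Fact.out
  obtain ⟨K, hK, H⟩ := exists_norm_sub_const_le Q hp hp_top
  choose D c hc hD hw using exists_polyDeriv Q p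
  let I := Finset.piAntidiag (Finset.univ : Finset (Fin N)) n
  refine ⟨I.card * (K * N), by positivity, fun u hu => ?_⟩
  have hconst : ∀ β : Fin N → ℕ, ∃ a : ℝ, order β = n →
      ‖weakDeriv Q β u - polyLp Q p (MvPolynomial.C a)‖ ≤ K * N * gradNorm Q (n + 1) u := by
    intro β
    by_cases hβ : order β = n
    swap
    · exact ⟨0, fun h => absurd h hβ⟩
    have ho (i : Fin N) : order (β + Pi.single i 1) = n + 1 := by
      rw [order_add, order_single, hβ]
    obtain ⟨a, ha⟩ := H (weakDeriv Q β u) (fun i => weakDeriv Q (β + Pi.single i 1) u) fun i =>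
      (isWeakDeriv_weakDeriv hu (by omega)).of_add (isWeakDeriv_weakDeriv hu (ho i).le)
    refine ⟨a, fun _ => ha.trans ?_⟩
    rw [mul_assoc]
    refine mul_le_mul_of_nonneg_left ?_ hK
    calc _ ≤ ∑ i : Fin N, gradNorm Q (n + 1) u := Finset.sum_le_sum fun i _ => by
          rw [← ho i]; exact norm_weakDeriv_le_gradNorm u
      _ = _ := by simp
  choose a ha using hconst
  let P : MvPolynomial (Fin N) ℝ :=
    ∑ β ∈ I, MvPolynomial.monomial (Finsupp.equivFunOnFinite.symm β) (a β / c β 0)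
  have hcoeff (μ : Fin N →₀ ℕ) : P.coeff μ = if Finsupp.degree μ = n then a μ / c μ 0 else 0 := by
    simp only [P, MvPolynomial.coeff_sum, MvPolynomial.coeff_monomial]
    have e (β : Fin N → ℕ) : Finsupp.equivFunOnFinite.symm β = μ ↔ β = (μ : Fin N → ℕ) := by
      rw [Equiv.symm_apply_eq]; rfl
    simp only [e, Finset.sum_ite_eq', I, mem_piAntidiag_iff_order, order_coe]
  refine ⟨P, fun μ hμ => by rw [hcoeff, if_neg (by omega)], ?_⟩
  rw [gradNorm, mul_assoc]
  refine (Finset.sum_le_card_nsmul I _ (K * N * gradNorm Q (n + 1) u) fun β hβ => ?_).trans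
    (by rw [nsmul_eq_mul])
  have hβ' := mem_piAntidiag_iff_order.1 hβ
  have hDP : D β P = MvPolynomial.C (a β) := by
    ext μ
    rw [hD, hcoeff, map_add, degree_toFinsupp, hβ', MvPolynomial.coeff_C]
    by_cases hμ : μ = 0
    · subst hμ
      have := hc β 0
      simp only [map_zero, zero_add, if_true, Finsupp.coe_equivFunOnFinite_symm]
      field_simp
    · have : Finsupp.degree μ ≠ 0 := fun h => hμ ((Finsupp.degree_eq_zero_iff μ).1 h)
      rw [if_neg (by omega), if_neg (Ne.symm hμ), mul_zero]
  rw [weakDeriv_sub hp hu (polyLp_mem_sobolev Q p _ P) (by omega), weakDeriv_eq hp (hw β P), hDP]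
  exact ha β hβ'

/-- Polynomial approximation in Sobolev spaces (Deny–Lions, Bramble–Hilbert). -/
theorem exists_poly_sum_gradNorm_le (Q : Cube N) (hp_top : p ≠ ⊤) (n : ℕ) :
    ∃ K : ℝ, 0 ≤ K ∧ ∀ u ∈ sobolev Q n p, ∃ P : MvPolynomial (Fin N) ℝ,
      (∀ μ, n ≤ Finsupp.degree μ → P.coeff μ = 0) ∧
      ∑ i ∈ Finset.range n, gradNorm Q i (u - polyLp Q p P) ≤ K * gradNorm Q n u := by
  have hp : 1 ≤ p := Fact.out
  choose D c hc hD hw using exists_polyDeriv Q p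
  induction n with
  | zero => exact ⟨0, le_rfl, fun u _ => ⟨0, by simp, by simp⟩⟩
  | succ n ih =>
    obtain ⟨K, hK, H⟩ := ih
    obtain ⟨K', hK', H'⟩ := exists_poly_weakDeriv_near Q hp_top n
    refine ⟨(K + 1) * K', by positivity, fun u hu => ?_⟩
    obtain ⟨P₁, hP₁, h₁⟩ := H' u hu
    have hv : u - polyLp Q p P₁ ∈ sobolev Q n p :=
      sobolev_anti (Nat.le_succ n) (sobolev_sub hp hu (polyLp_mem_sobolev Q p _ P₁))
    obtain ⟨P₂, hP₂, h₂⟩ := H _ hv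
    refine ⟨P₁ + P₂, fun μ hμ => ?_, ?_⟩
    · rw [MvPolynomial.coeff_add, hP₁ μ (by omega), hP₂ μ (by omega), add_zero]
    -- `P₂` has degree below `n`, so correcting the lower derivatives does not disturb those of
    -- order `n`.
    have htop : gradNorm Q n (u - polyLp Q p P₁ - polyLp Q p P₂) =
        gradNorm Q n (u - polyLp Q p P₁) := by
      refine Finset.sum_congr rfl fun β hβ => ?_
      have hβ' := mem_piAntidiag_iff_order.1 hβ
      have h0 : D β P₂ = 0 := by
        ext μ
        rw [hD, hP₂ _ (by rw [map_add, degree_toFinsupp]; omega), mul_zero, MvPolynomial.coeff_zero]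
      rw [weakDeriv_sub hp hv (polyLp_mem_sobolev Q p _ P₂) hβ'.le, weakDeriv_eq hp (hw β P₂), h0,
        polyLp_zero, sub_zero]
    rw [polyLp_add, ← sub_sub, Finset.sum_range_succ, htop]
    calc _ ≤ K * gradNorm Q n (u - polyLp Q p P₁) + gradNorm Q n (u - polyLp Q p P₁) := by gcongr
      _ = (K + 1) * gradNorm Q n (u - polyLp Q p P₁) := by ring
      _ ≤ (K + 1) * (K' * gradNorm Q (n + 1) u) := by gcongr
      _ = _ := by ring

end Approximation

/-! ### Admissible derivatives and comparison of capacities -/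

theorem exists_le_order_eq (β : Fin N → ℕ) {s : ℕ} (h : s ≤ order β) :
    ∃ γ : Fin N → ℕ, γ ≤ β ∧ order γ = s := by
  induction β using multiIndex_induction with
  | zero => exact ⟨0, le_rfl, by rw [order_zero] at h ⊢; omega⟩
  | step β i ih =>
    rw [order_add, order_single] at h
    rcases Nat.lt_or_ge (order β) s with hs | hs
    · exact ⟨_, le_rfl, by rw [order_add, order_single]; omega⟩
    · obtain ⟨γ, hγ, ho⟩ := ih hs
      exact ⟨γ, hγ.trans le_self_add, ho⟩

theorem exists_ge_order_eq (hN : 0 < N) (δ : Fin N → ℕ) {s : ℕ} (h : order δ ≤ s) :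
    ∃ γ : Fin N → ℕ, δ ≤ γ ∧ order γ = s :=
  ⟨δ + Pi.single ⟨0, hN⟩ (s - order δ), le_self_add, by rw [order_add, order_single]; omega⟩

theorem theta_le_of_mem {p : ℝ≥0∞} {Q : Cube N}
    {Proj : ℕ → Lp ℝ p Q.vol → MvPolynomial (Fin N) ℝ}
    {α : ℝ} {m k : ℕ} {A : Set (Lp ℝ p Q.vol)} {u : Lp ℝ p Q.vol}
    (hu : u ∈ testSet Q Proj α m k A) (h0 : lowNorm Q p k (Proj (m - 1) u) ≠ 0) :
    theta Q Proj α m k A ≤ ENNReal.ofReal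
      (gradNorm Q m u ^ p.toReal / lowNorm Q p k (Proj (m - 1) u) ^ p.toReal) :=
  (min_le_left _ _).trans (iInf₂_le u ⟨hu, h0⟩)

section

variable {p : ℝ≥0∞} [Fact (1 ≤ p)]

/-- The derivative `S` of `P` competes with `R` in the minimization for `D^γ u`, and the derivatives
of `D^γ (u - P)` are among those of `u - P`. The `L^p` norm is the term of order 0. -/
theorem IsBestPoly.sum_gradNorm_le {Q : Cube N} {m : ℕ} {u : Lp ℝ p Q.vol}
    (hu : u ∈ sobolev Q m p) {γ : Fin N → ℕ} (hγ : order γ < m) {P R S : MvPolynomial (Fin N) ℝ}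
    (hR : IsBestPoly Q (m - order γ - 1) (weakDeriv Q γ u) R)
    (hS : IsWeakDeriv Q γ (polyLp Q p P) (polyLp Q p S)) (hSd : S.totalDegree ≤ m - order γ - 1) :
    ‖weakDeriv Q γ u - polyLp Q p R‖ ≤ ∑ i ∈ Finset.range m, gradNorm Q i (u - polyLp Q p P) ∧
    ‖weakDeriv Q γ u - polyLp Q p S‖ ≤ ∑ i ∈ Finset.range m, gradNorm Q i (u - polyLp Q p P) := by
  have hp : 1 ≤ p := Fact.out
  have hsob : u - polyLp Q p P ∈ sobolev Q m p := sobolev_sub hp hu (polyLp_mem_sobolev Q p m P)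
  have hr : m - order γ - 1 + 1 = m - order γ := by omega
  have hnorm (v : Lp ℝ p Q.vol) :
      ‖v‖ ≤ ∑ i ∈ Finset.range (m - order γ - 1 + 1), gradNorm Q i v := by
    rw [← gradNorm_zero hp]
    exact Finset.single_le_sum (f := fun i => gradNorm Q i v) (fun _ _ => gradNorm_nonneg _ _)
      (Finset.mem_range.2 (by omega))
  have hsum : ∑ i ∈ Finset.range (m - order γ - 1 + 1),
      gradNorm Q i (weakDeriv Q γ u - polyLp Q p S) ≤
      ∑ i ∈ Finset.range m, gradNorm Q i (u - polyLp Q p P) := by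
    have e : weakDeriv Q γ u - polyLp Q p S = weakDeriv Q γ (u - polyLp Q p P) := by
      rw [weakDeriv_sub hp hu (polyLp_mem_sobolev Q p m P) hγ.le, weakDeriv_eq hp hS]
    rw [e, hr]
    calc _ ≤ ∑ i ∈ Finset.range (m - order γ), gradNorm Q (order γ + i) (u - polyLp Q p P) :=
          Finset.sum_le_sum fun i hi => gradNorm_weakDeriv_le hp hsob (by
            have := Finset.mem_range.1 hi
            omega)
      _ = ∑ i ∈ Finset.Ico (order γ) m, gradNorm Q i (u - polyLp Q p P) := by
          rw [Finset.sum_Ico_eq_sum_range]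
      _ ≤ _ := Finset.sum_le_sum_of_subset_of_nonneg (fun i hi => by
          rw [Finset.mem_range]; exact (Finset.mem_Ico.1 hi).2) fun _ _ _ => gradNorm_nonneg _ _
  exact ⟨(hnorm _).trans ((hR.2 S hSd).trans hsum), (hnorm _).trans hsum⟩

/-- If `∇^m u` is small compared with the low part of its best polynomial, then the derivatives of
`u` that keep the largest coefficient of that low part are again admissible. -/
theorem exists_weakDeriv_admissible (Q : Cube N) (hp_top : p ≠ ⊤) (m : ℕ) {α : ℝ} (hα : 0 < α) :
    ∃ α' ε c : ℝ, 0 < α' ∧ 0 < ε ∧ 0 < c ∧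
      ∀ Proj : ℕ → Lp ℝ p Q.vol → MvPolynomial (Fin N) ℝ, IsProjection Q p Proj →
      ∀ k < m, ∀ u ∈ sobolev Q m p, lowNorm Q p k (Proj (m - 1) u) ≠ 0 →
        α * coNorm Q p k (Proj (m - 1) u) ≤ lowNorm Q p k (Proj (m - 1) u) →
        gradNorm Q m u ≤ ε * lowNorm Q p k (Proj (m - 1) u) →
        ∃ β : Fin N → ℕ, order β ≤ k ∧ ∀ γ ≤ β, ∀ k' ≤ m, order β ≤ k' + order γ →
          α' * coNorm Q p k' (Proj (m - order γ - 1) (weakDeriv Q γ u)) ≤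
            lowNorm Q p k' (Proj (m - order γ - 1) (weakDeriv Q γ u)) ∧
          ‖weakDeriv Q γ u - polyLp Q p (Proj (m - order γ - 1) (weakDeriv Q γ u))‖ ≤
            1 / 2 * ‖polyLp Q p (Proj (m - order γ - 1) (weakDeriv Q γ u))‖ ∧
          c * lowNorm Q p k (Proj (m - 1) u) ≤
            lowNorm Q p k' (Proj (m - order γ - 1) (weakDeriv Q γ u)) := by
  choose D d hd hD hDw using exists_polyDeriv Q p
  obtain ⟨K₁, hK₁, hBH⟩ := exists_poly_sum_gradNorm_le Q hp_top m
  obtain ⟨c₀, hc₀, hlow⟩ := exists_coeff_ge_lowNorm (p := p) Q m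
  have hb : ∀ P : MvPolynomial (Fin N) ℝ, 0 ≤ ‖polyLp Q p P‖ := fun P => norm_nonneg _
  obtain ⟨Kc, hKc, hcoeff⟩ := exists_uniform_bound (Finset.Iic fun _ : Fin N => m)
    {P : MvPolynomial (Fin N) ℝ | P.totalDegree ≤ m} hb fun μ =>
      exists_norm_map_le Q m (MvPolynomial.lcoeff ℝ (Finsupp.equivFunOnFinite.symm μ))
  obtain ⟨Kco, hKco, hco⟩ := exists_uniform_bound (Finset.range (m + 1))
    {P : MvPolynomial (Fin N) ℝ | P.totalDegree ≤ m} hb fun k =>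
      exists_norm_map_le Q m (polyLin Q p ∘ₗ (LinearMap.id - lowLin k))
  obtain ⟨KD, hKD, hDb⟩ := exists_uniform_bound (Finset.Iic fun _ : Fin N => m)
    {P : MvPolynomial (Fin N) ℝ | P.totalDegree ≤ m} hb fun γ =>
      exists_norm_map_le Q m (polyLin Q p ∘ₗ D γ)
  -- With this `η`, replacing `D^γ P` by `R`, at distance at most `2 * η * L`, costs at most half of
  -- the coefficient `c₀ * L`.
  set η := c₀ / (4 * Kc) with hη
  have hη0 : 0 < η := by positivity
  -- `B * L` will bound the norm of `R`: the first term comes from `D^γ P`, the second from `R - D^γ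
  -- P`.
  set B := KD * (1 + 1 / α) + 2 * η with hB
  have hB0 : 0 < B := by positivity
  refine ⟨2 * η / (Kco * B), η / (K₁ + 1), 2 * η, by positivity, by positivity, by positivity, ?_⟩
  intro Proj hProj k hk u hu hL hT hε
  set P := Proj (m - 1) u with hP
  set L := lowNorm Q p k P with hLdef
  have hL0 : 0 < L := lt_of_le_of_ne (norm_nonneg _) (Ne.symm hL)
  have hm : m - 1 + 1 = m := by omega
  obtain ⟨hPd, hPbest⟩ := hProj (m - 1) u (by rwa [hm])
  rw [← hP, hm] at hPbest
  set e := ∑ i ∈ Finset.range m, gradNorm Q i (u - polyLp Q p P) with he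
  -- `P` does at least as well as the Deny–Lions polynomial; the `+ 1` in `ε` covers `K₁ = 0`.
  have heL : e ≤ η * L := by
    obtain ⟨P', hP'd, hP'⟩ := hBH u hu
    have h1 := hPbest P' (totalDegree_le_iff_coeff.2 fun μ hμ => hP'd μ (by omega))
    calc e ≤ K₁ * gradNorm Q m u := h1.trans hP'
      _ ≤ K₁ * (η / (K₁ + 1) * L) := by gcongr
      _ = K₁ / (K₁ + 1) * (η * L) := by field_simp
      _ ≤ 1 * (η * L) := by
          gcongr
          rw [div_le_one (by positivity)]; linarith
      _ = η * L := one_mul _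
  have hPn : ‖polyLp Q p P‖ ≤ (1 + 1 / α) * L := by
    have h1 : ‖polyLp Q p P‖ ≤ L + coNorm Q p k P := by
      have : polyLp Q p P = polyLp Q p (lowPart k P) + polyLp Q p (P - lowPart k P) := by
        rw [← polyLp_add]; congr 1; ring
      rw [this]
      exact norm_add_le _ _
    have h2 : coNorm Q p k P ≤ L / α := by rw [le_div_iff₀ hα, mul_comm]; exact hT
    calc _ ≤ L + L / α := by linarith
      _ = _ := by ring
  obtain ⟨β, hβk, hβ⟩ := hlow k P hk.le hL
  refine ⟨β, hβk, fun γ hγ k' hk' hγk' => ?_⟩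
  have hβ_eq : β - γ + γ = β := tsub_add_cancel_of_le hγ
  have ho := order_add (β - γ) γ
  rw [hβ_eq] at ho
  have hγm : order γ < m := by omega
  set w := weakDeriv Q γ u with hw
  set R := Proj (m - order γ - 1) w with hR
  have hRbest : IsBestPoly Q (m - order γ - 1) w R :=
    hProj _ _ (weakDeriv_mem_sobolev hu (by omega))
  have hDd : (D γ P).totalDegree ≤ m - order γ - 1 := by
    refine totalDegree_le_iff_coeff.2 fun μ hμ => ?_
    rw [hD, totalDegree_le_iff_coeff.1 hPd _ (by rw [map_add, degree_toFinsupp]; omega), mul_zero]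
  obtain ⟨hwR, hwD⟩ := hRbest.sum_gradNorm_le hu hγm (hDw γ P) hDd
  rw [← he] at hwR hwD
  have hRm : R.totalDegree ≤ m := hRbest.1.trans (by omega)
  have hDm : (D γ P).totalDegree ≤ m := hDd.trans (by omega)
  have hRD : ‖polyLp Q p (D γ P - R)‖ ≤ 2 * (η * L) := by
    have : polyLp Q p (D γ P - R) = (w - polyLp Q p R) - (w - polyLp Q p (D γ P)) := by
      rw [polyLp_sub]; abel
    rw [this]
    refine (norm_sub_le _ _).trans ?_
    linarith
  have hμmem : β - γ ∈ Finset.Iic fun _ : Fin N => m := mem_Iic_of_order_le (by omega)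
  set μ : Fin N →₀ ℕ := Finsupp.equivFunOnFinite.symm (β - γ) with hμ
  have hμdeg : Finsupp.degree μ ≤ k' := by rw [hμ, degree_toFinsupp]; omega
  have hcf (S : MvPolynomial (Fin N) ℝ) (hS : S.totalDegree ≤ m) :
      |S.coeff μ| ≤ Kc * ‖polyLp Q p S‖ := hcoeff _ hμmem S hS
  have hDcoeff : c₀ * L ≤ |(D γ P).coeff μ| := by
    have h1 : μ + Finsupp.equivFunOnFinite.symm γ = Finsupp.equivFunOnFinite.symm β := by
      ext i
      simpa [hμ] using congrFun hβ_eq i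
    rw [hD, h1, abs_mul, abs_of_pos (zero_lt_one.trans_le (hd γ μ))]
    exact hβ.trans (le_mul_of_one_le_left (abs_nonneg _) (hd γ μ))
  have hKη : Kc * (4 * η) = c₀ := by rw [hη]; field_simp
  have hRcoeff : Kc * (2 * η * L) ≤ |R.coeff μ| := by
    have h1 := hcf (D γ P - R) ((MvPolynomial.totalDegree_sub _ _).trans (max_le hDm hRm))
    rw [MvPolynomial.coeff_sub] at h1
    have h2 := abs_sub_abs_le_abs_sub ((D γ P).coeff μ) (R.coeff μ)
    have h3 := mul_le_mul_of_nonneg_left hRD hKc.le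
    have h4 : c₀ * L = Kc * (4 * η) * L := by rw [hKη]
    linarith
  have hRlow : 2 * η * L ≤ ‖polyLp Q p R‖ :=
    le_of_mul_le_mul_left (hRcoeff.trans (hcf R hRm)) hKc
  -- The exponent `β - γ` has degree at most `k'`, so truncation keeps its coefficient.
  have hlowR : 2 * η * L ≤ lowNorm Q p k' R := by
    refine le_of_mul_le_mul_left (hRcoeff.trans ?_) hKc
    have h1 := hcf (lowPart k' R) (totalDegree_le_iff_coeff.2 fun ν hν => by
      rw [coeff_lowPart, totalDegree_le_iff_coeff.1 hRm ν hν, ite_self])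
    rwa [coeff_lowPart, if_pos hμdeg] at h1
  have hRup : ‖polyLp Q p R‖ ≤ B * L := by
    have h1 : ‖polyLp Q p (D γ P)‖ ≤ KD * ‖polyLp Q p P‖ :=
      hDb γ (mem_Iic_of_order_le hγm.le) P (hPd.trans (by omega))
    have h2 : polyLp Q p R = polyLp Q p (D γ P) - polyLp Q p (D γ P - R) := by
      rw [polyLp_sub]; abel
    have h3 := norm_sub_le (polyLp Q p (D γ P)) (polyLp Q p (D γ P - R))
    rw [← h2] at h3
    have h4 := mul_le_mul_of_nonneg_left hPn hKD.le
    rw [hB]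
    linarith
  refine ⟨?_, ?_, hlowR⟩
  · have h1 : coNorm Q p k' R ≤ Kco * ‖polyLp Q p R‖ := by
      have := hco k' (Finset.mem_range.2 (by omega)) R hRm
      rwa [LinearMap.comp_apply, LinearMap.sub_apply, LinearMap.id_apply, lowLin_apply] at this
    refine le_trans ?_ hlowR
    calc _ ≤ 2 * η / (Kco * B) * (Kco * (B * L)) := by
          gcongr
          exact h1.trans (by gcongr)
      _ = 2 * η * L := by field_simp
  -- The error is at most `e ≤ η * L`, half of the lower bound `2 * η * L` for the norm of `R`.
  · linarith

/-- The proposition for a single `u`, with `γ` and `δ` allowed to depend on `u`. -/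
theorem exists_theta_weakDeriv_le (hN : 0 < N) (Q : Cube N) (hp_top : p ≠ ⊤) (m : ℕ) {α : ℝ}
    (hα : 0 < α) :
    ∃ α' : ℝ, 0 < α' ∧ ∃ C : ℝ, 1 ≤ C ∧
      ∀ Proj : ℕ → Lp ℝ p Q.vol → MvPolynomial (Fin N) ℝ, IsProjection Q p Proj →
      ∀ k s : ℕ, k < m → s ≤ k → ∀ A ⊆ sobolev Q m p, ∀ u ∈ testSet Q Proj α m k A,
        lowNorm Q p k (Proj (m - 1) u) ≠ 0 →
        ∃ γ : Fin N → ℕ, order γ = s ∧ ∃ δ : Fin N → ℕ, δ ≤ γ ∧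
          min (theta Q Proj α' (m - s) (k - s) (weakDeriv Q γ '' A))
            (theta Q Proj α' (m - order δ) 0 (weakDeriv Q δ '' A)) ≤
          ENNReal.ofReal C * ENNReal.ofReal
            (gradNorm Q m u ^ p.toReal / lowNorm Q p k (Proj (m - 1) u) ^ p.toReal) := by
  have hp : 1 ≤ p := Fact.out
  have hq0 : 0 < p.toReal := ENNReal.toReal_pos (zero_lt_one.trans_le hp).ne' hp_top
  obtain ⟨α', ε, c, hα', hε, hc, H⟩ := exists_weakDeriv_admissible (p := p) Q hp_top m hα
  set q := p.toReal
  have hεq : 0 < (ε ^ q)⁻¹ := by positivity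
  have hcq : 0 < (c ^ q)⁻¹ := by positivity
  -- The three summands serve the cap 1 in the capacity, the case of large gradient, and the loss
  -- `c` in the low part.
  refine ⟨α', hα', 1 + (ε ^ q)⁻¹ + (c ^ q)⁻¹, by linarith, ?_⟩
  intro Proj hProj k s hk hs A hA u hu hL
  set L := lowNorm Q p k (Proj (m - 1) u) with hLdef
  have hL0 : 0 < L := lt_of_le_of_ne (norm_nonneg _) (Ne.symm hL)
  have hg0 : 0 ≤ gradNorm Q m u := gradNorm_nonneg _ _
  rw [← ENNReal.ofReal_mul (by positivity)]
  rcases lt_or_ge (ε * L) (gradNorm Q m u) with hbig | hsmall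
  · obtain ⟨γ, hγ⟩ := exists_ge_order_eq hN 0 (s := s) (by simp [order_zero])
    refine ⟨γ, hγ.2, 0, hγ.1, (min_le_left _ _).trans ((min_le_right _ _).trans ?_)⟩
    rw [← ENNReal.ofReal_one]
    refine ENNReal.ofReal_le_ofReal ?_
    have h1 : ε ^ q ≤ gradNorm Q m u ^ q / L ^ q := by
      rw [le_div_iff₀ (by positivity), ← Real.mul_rpow hε.le hL0.le]
      exact Real.rpow_le_rpow (by positivity) hbig.le hq0.le
    calc (1 : ℝ) = (ε ^ q)⁻¹ * ε ^ q := (inv_mul_cancel₀ (by positivity)).symm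
      _ ≤ (1 + (ε ^ q)⁻¹ + (c ^ q)⁻¹) * (gradNorm Q m u ^ q / L ^ q) := by
          gcongr
          linarith
  obtain ⟨β, hβk, hβ⟩ := H Proj hProj k hk u (hA hu.1) hL hu.2.1 hsmall
  have key (γ : Fin N → ℕ) (hγ : γ ≤ β) (k' : ℕ) (hk' : k' ≤ m) (ho : order β ≤ k' + order γ) :
      theta Q Proj α' (m - order γ) k' (weakDeriv Q γ '' A) ≤
        ENNReal.ofReal ((1 + (ε ^ q)⁻¹ + (c ^ q)⁻¹) * (gradNorm Q m u ^ q / L ^ q)) := by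
    obtain ⟨h1, h2, h3⟩ := hβ γ hγ k' hk' ho
    have hoγ : order γ ≤ order β := Finset.sum_le_sum fun i _ => hγ i
    have hL' : 0 < lowNorm Q p k' (Proj (m - order γ - 1) (weakDeriv Q γ u)) :=
      (mul_pos hc hL0).trans_le h3
    have hmem : weakDeriv Q γ u ∈
        testSet Q Proj α' (m - order γ) k' (weakDeriv Q γ '' A) := ⟨⟨u, hu.1, rfl⟩, h1, h2⟩
    refine (theta_le_of_mem hmem hL'.ne').trans (ENNReal.ofReal_le_ofReal ?_)
    have hgrad : gradNorm Q (m - order γ) (weakDeriv Q γ u) ≤ gradNorm Q m u := by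
      have e : order γ + (m - order γ) = m := by omega
      have := gradNorm_weakDeriv_le hp (hA hu.1) (γ := γ) e.le
      rwa [e] at this
    calc _ ≤ gradNorm Q m u ^ q / (c * L) ^ q := by
          have := gradNorm_nonneg (m - order γ) (weakDeriv Q γ u)
          gcongr
      _ = (c ^ q)⁻¹ * (gradNorm Q m u ^ q / L ^ q) := by
          rw [Real.mul_rpow hc.le hL0.le]; field_simp
      _ ≤ _ := by
          gcongr
          linarith
  -- Either `s` derivatives can be taken without passing `β`, or all of `β` is used up and the
  -- surviving coefficient is the constant term.
  rcases le_total s (order β) with hsβ | hsβ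
  · obtain ⟨γ, hγ, ho⟩ := exists_le_order_eq β hsβ
    refine ⟨γ, ho, 0, zero_le, (min_le_left _ _).trans ?_⟩
    have := key γ hγ (k - s) (by omega) (by omega)
    rwa [ho] at this
  · obtain ⟨γ, hγ, ho⟩ := exists_ge_order_eq hN β hsβ
    exact ⟨γ, ho, β, hγ, (min_le_right _ _).trans (key β le_rfl 0 (Nat.zero_le _) (by omega))⟩

end

end PolyCap

end

theorem proposition2p19 {N : ℕ} (hN : 0 < N) (Q : PolyCap.Cube N) (p : ENNReal)
    (hp : 1 ≤ p) (hp_top : p ≠ ⊤) (m : ℕ) (α : ℝ) (hα : 0 < α) :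
    ∃ α' : ℝ, 0 < α' ∧ ∃ C : ℝ, 0 < C ∧
      ∀ Proj : ℕ → MeasureTheory.Lp ℝ p Q.vol → MvPolynomial (Fin N) ℝ,
        PolyCap.IsProjection Q p Proj →
      ∀ k s : ℕ, k < m → 0 < s → s ≤ k →
      ∀ A : Set (MeasureTheory.Lp ℝ p Q.vol), A ⊆ PolyCap.sobolev Q m p →
        ∃ γ : Fin N → ℕ, PolyCap.order γ = s ∧ ∃ δ : Fin N → ℕ, δ ≤ γ ∧
          (PolyCap.theta Q Proj α' (m - s) (k - s) (PolyCap.weakDeriv Q γ '' A) ≤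
              ENNReal.ofReal C * PolyCap.theta Q Proj α m k A ∨
            PolyCap.theta Q Proj α' (m - PolyCap.order δ) 0 (PolyCap.weakDeriv Q δ '' A) ≤
              ENNReal.ofReal C * PolyCap.theta Q Proj α m k A) := by
  classical
  have : Fact (1 ≤ p) := ⟨hp⟩
  obtain ⟨α', hα', C, hC, H⟩ := PolyCap.exists_theta_weakDeriv_le (p := p) hN Q hp_top m hα
  have hC0 : 0 < C := zero_lt_one.trans_le hC
  refine ⟨α', hα', C, hC0, fun Proj hProj k s hk _ hs A hA => ?_⟩
  -- All pairs `(γ, δ)` lie in a finite box, so a minimizing pair exists and is chosen before `u`.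
  let J := Finset.Iic fun _ : Fin N => s
  let F := (J ×ˢ J).filter fun z => PolyCap.order z.1 = s ∧ z.2 ≤ z.1
  have hF (γ δ : Fin N → ℕ) : (γ, δ) ∈ F ↔ PolyCap.order γ = s ∧ δ ≤ γ := by
    refine Finset.mem_filter.trans ⟨fun h => h.2, fun h => ⟨?_, h⟩⟩
    have h1 : γ ∈ J := PolyCap.mem_Iic_of_order_le h.1.le
    exact Finset.mem_product.2 ⟨h1, Finset.mem_Iic.2 (h.2.trans (Finset.mem_Iic.1 h1))⟩
  obtain ⟨γ₁, hγ₁, ho₁⟩ := PolyCap.exists_ge_order_eq hN 0 (s := s) (by simp [PolyCap.order_zero])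
  obtain ⟨⟨γ, δ⟩, hmem, hmin⟩ := Finset.exists_min_image F
    (fun z => min (PolyCap.theta Q Proj α' (m - s) (k - s) (PolyCap.weakDeriv Q z.1 '' A))
      (PolyCap.theta Q Proj α' (m - PolyCap.order z.2) 0 (PolyCap.weakDeriv Q z.2 '' A)))
    ⟨(γ₁, 0), (hF _ _).2 ⟨ho₁, hγ₁⟩⟩
  obtain ⟨hγ, hδ⟩ := (hF _ _).1 hmem
  refine ⟨γ, hγ, δ, hδ, min_le_iff.1 ?_⟩
  have hC' : ENNReal.ofReal C ≠ 0 := (ENNReal.ofReal_pos.2 hC0).ne'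
  rw [← ENNReal.div_le_iff' hC' ENNReal.ofReal_ne_top]
  refine le_min (le_iInf₂ fun u hu => ?_) ?_
  · rw [ENNReal.div_le_iff' hC' ENNReal.ofReal_ne_top]
    obtain ⟨γ', hγ', δ', hδ', h⟩ := H Proj hProj k s hk hs A hA u hu.1 hu.2
    exact (hmin (γ', δ') ((hF _ _).2 ⟨hγ', hδ'⟩)).trans h
  · rw [ENNReal.div_le_iff' hC' ENNReal.ofReal_ne_top, mul_one]
    refine (min_le_left _ _).trans ((min_le_right _ _).trans ?_)
    rw [← ENNReal.ofReal_one]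
    exact ENNReal.ofReal_le_ofReal hC
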